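/- Let $n\ge 1$ and let $D_n=\langle r,s\mid r^n=s^2=1,\ srs=r^{-1}\rangle$ be the dihedral group of order $2n$, with subgroups $D_1=\{1,s\}$ and $C_{n/d}=\langle r^d\rangle$ for $d\mid n$. Let $X$ be a finite $D_n$-set isomorphic to $D_n/D_1$ (for instance, the set of vertices of a regular $n$-gon with $D_n$ acting by rotations and reflections). Let $A$ be a finite set of colors, $a\in A$ and $A'=A\setminus\{a\}$. For a finite group $G$, a subgroup $H$ and a $G$-set $S$, let $\mu_H(S)$ be the number of $G$-orbits in $S$ isomorphic to $G/H$. Let $J=\big(A'^{[0]}\sqcup A'^{[1]}\big)^X$, where $A'^{[0]}$ has exactly one element and $A'^{[1]}$ is the set of maps $\{1\}\to A'$, with action $(gf)(x)=f(g^{-1}x)$; let $J^i\subseteq J$ be the set of $f$ with exactly $i$ points $x$ such that $f(x)\in A'^{[1]}$, and put $\mu_{H,t}(J)=\sum_{i\ge0}\mu_H(J^i)t^i$. A coloring $f\in A^X$ is primitive if $|D_nf|=|D_n|$; primitive colorings are counted up to the action of $D_n$. Write $\mu$ for the Möbius function, $M(k,m)=\frac1m\sum_{e\mid m}\mu(m/e)k^e$,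 and $F_i=1+|A'|t^i$. For every divisor $d$ of $n$ the following hold. (I) If $2\nmid d$, then $$\mu_{C_{n/d},t}(J)=\sum_{e\mid d}\mu\Big(\frac de\Big)\Big(\frac1{2d}F_{n/e}^{\,e}-\frac12F_{n/e}F_{2n/e}^{(e-1)/2}\Big),$$ $$\mu_{C_{n/d}}(J)=\frac12\Big(M(|A|,d)-d\sqrt{|A|}\,M(\sqrt{|A|},d)\Big).$$ (II) If $2\mid d$ and $4\nmid d$, then $$\mu_{C_{n/d},t}(J)=\frac1{2d}\sum_{e\mid d}\mu\Big(\frac de\Big)F_{n/e}^{\,e}-\frac14\sum_{e\mid d/2}\mu\Big(\frac d{2e}\Big)\Big(-2F_{n/e}F_{2n/e}^{(e-1)/2}+F_{n/(2e)}^{2}F_{n/e}^{\,e-1}+F_{n/e}^{\,e}\Big),$$ $$\mu_{C_{n/d}}(J)=\frac12M(|A|,d)-\frac d8(|A|+1)M\Big(|A|,\frac d2\Big)+\frac d4\sqrt{|A|}\,M\Big(\sqrt{|A|},\frac d2\Big).$$ (III) If $4\mid d$, then (odd $e$ contributing $0$, since then $\mu(d/e)=0$) $$\mu_{C_{n/d},t}(J)=\sum_{e\mid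 d}\mu\Big(\frac de\Big)\Big(\frac1{2d}F_{n/e}^{\,e}-\frac14F_{n/e}^{2}F_{2n/e}^{e/2-1}-\frac14F_{2n/e}^{e/2}\Big),$$ $$\mu_{C_{n/d}}(J)=\frac12M(|A|,d)-\frac d4(|A|+1)M(\sqrt{|A|},d).$$ Moreover, for $d=n$ the coefficient of $t^i$ in $\mu_{C_1,t}(J)$ is the number of primitive colorings of $X$ in which exactly $i$ points have a color different from $a$, and $\mu_{C_1}(J)$ is the number of all primitive colorings of $X$ with $A$. Hence this number is $\frac12\big(M(|A|,n)-n\sqrt{|A|}M(\sqrt{|A|},n)\big)$ if $n$ is odd, $\frac12M(|A|,n)-\frac n8(|A|+1)M(|A|,\frac n2)+\frac n4\sqrt{|A|}M(\sqrt{|A|},\frac n2)$ if $n\equiv2\pmod 4$, and $\frac12M(|A|,n)-\frac n4(|A|+1)M(\sqrt{|A|},n)$ if $4\mid n$. -/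

import Mathlib

/-! ### `G`-sets -/

/-- Two `G`-sets are `G`-isomorphic: there is an equivariant bijection between them. -/
def GIsomorphic (G : Type*) [Group G] (S T : Type*) [MulAction G S] [MulAction G T] : Prop :=
  ∃ e : S ≃ T, ∀ (g : G) (s : S), e (g • s) = g • e s

/-- `μ_H(S)`: the number of orbits of the `G`-set `S` which are `G`-isomorphic to `G/H`. -/
noncomputable def orbitCount {G : Type*} [Group G] (H : Subgroup G)
    (S : Type*) [MulAction G S] : ℕ :=
  Nat.card {ω : MulAction.orbitRel.Quotient G S // GIsomorphic G ω.orbit (G ⧸ H)}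

/-- The set `T ^ S` of all maps from `S` to `T`. -/
def MapSet (S T : Type*) : Type _ := S → T

/-- The `G`-action on `T ^ S`, for a `G`-set `S` and a set `T` with trivial action:
`(g f)(s) = f (g⁻¹ s)`. -/
instance MapSet.mulAction (G : Type*) [Group G] (S T : Type*) [MulAction G S] :
    MulAction G (MapSet S T) where
  smul g f := fun s => f (g⁻¹ • s)
  one_smul f := by
    funext s
    change f ((1 : G)⁻¹ • s) = f s
    simp
  mul_smul g h f := by
    funext s
    change f ((g * h)⁻¹ • s) = f (h⁻¹ • g⁻¹ • s)
    rw [mul_inv_rev, mul_smul]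

/-! ### The `|A|`-colored `N`-nested `G`-set -/

/-- The disjoint union over `k ∈ N` of the sets `A' ^ [k]`, where `A' = A \ {a}`;
the set `A' ^ [0]` has exactly one element. -/
def NestedColor (N : Set ℕ) (A : Type*) (a : A) : Type _ :=
  Σ k : N, (Fin (k : ℕ) → {x : A // x ≠ a})

/-- `J_{N,A,a}(X)`: the maps from `X` to the union of the `A' ^ [k]`, `k ∈ N`. -/
abbrev NestedSet (N : Set ℕ) (A : Type*) (a : A) (X : Type*) : Type _ :=
  MapSet X (NestedColor N A a)

/-- The degree of an element of `J_{N,A,a}(X)`. -/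
def NestedSet.deg {N : Set ℕ} {A : Type*} {a : A} {X : Type*} [Fintype X]
    (f : NestedSet N A a X) : ℕ :=
  ∑ x : X, (((f x).1 : N) : ℕ)

/-- `J^i_{N,A,a}(X)`: the sub-`G`-set of the elements of degree `i`. -/
def nestedDegree (G : Type*) [Group G] (N : Set ℕ) (A : Type*) (a : A) (X : Type*) [Fintype X]
    [MulAction G X] (i : ℕ) : SubMulAction G (NestedSet N A a X) where
  carrier := {f | f.deg = i}
  smul_mem' g f hf := by
    have h : (g • f).deg = f.deg :=
      Fintype.sum_equiv (MulAction.toPerm g⁻¹) _ _ (fun _ => rfl)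
    exact h.trans hf

/-- `μ_{H,t}(J_{N,A,a}(X))`: the power series whose coefficient of `t ^ i` is
`μ_H(J^i_{N,A,a}(X))`. -/
noncomputable def orbitSeries {G : Type*} [Group G] (H : Subgroup G) (N : Set ℕ)
    (A : Type*) (a : A) (X : Type*) [Fintype X] [MulAction G X] : PowerSeries ℚ :=
  PowerSeries.mk fun i => (orbitCount H (nestedDegree G N A a X i) : ℚ)

/-! ### Primitive colorings -/

/-- A coloring `f ∈ A ^ X` is primitive under `G` if `|G f| = |G|`. -/
def IsPrimitiveColoring (G : Type*) [Group G] {X A : Type*} [MulAction G X]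
    (f : MapSet X A) : Prop :=
  Nat.card (MulAction.orbit G f) = Nat.card G

/-- The number of primitive colorings of `X` with `A`, up to the action of `G`. -/
noncomputable def primitiveCount (G : Type*) [Group G] (X A : Type*) [MulAction G X] : ℕ :=
  Nat.card {ω : MulAction.orbitRel.Quotient G (MapSet X A) //
    ∃ f ∈ ω.orbit, IsPrimitiveColoring G f}

/-- The number, up to the action of `G`, of primitive colorings of `X` with `A` for which
exactly `i` elements of `X` have a color different from `a`. -/
noncomputable def primitiveCountDegree (G : Type*) [Group G] (X : Type*) {A : Type*}
    [MulAction G X] (a : A) (i : ℕ) : ℕ :=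
  Nat.card {ω : MulAction.orbitRel.Quotient G (MapSet X A) //
    ∃ f ∈ ω.orbit, IsPrimitiveColoring G f ∧ Nat.card {x : X // f x ≠ a} = i}

/-! ### The dihedral group and the regular polygon -/

/-- The subgroup `C_{n/d} = ⟨r ^ d⟩` of the dihedral group of order `2 n`, for `d ∣ n`. -/
def dihedralC (n d : ℕ) : Subgroup (DihedralGroup n) :=
  Subgroup.zpowers (DihedralGroup.r (d : ZMod n))

/-- The subgroup `D_1 = {1, s}` of the dihedral group of order `2 n`, `s` being a reflection. -/
def dihedralD1 (n : ℕ) : Subgroup (DihedralGroup n) :=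
  Subgroup.zpowers (DihedralGroup.sr 0)

/-- The vertices `exp (2 π i j / n)`, `j ∈ ℤ/n`, of a regular `n`-gon in the complex plane. -/
def PolygonVertex (n : ℕ) [NeZero n] : Type :=
  {z : ℂ // ∃ j : ZMod n, ZMod.stdAddChar j = z}

/-- `r j` is the rotation `z ↦ exp (2 π i j / n) z`, and `sr j` is that rotation followed by
complex conjugation. -/
noncomputable instance PolygonVertex.mulAction (n : ℕ) [NeZero n] :
    MulAction (DihedralGroup n) (PolygonVertex n) where
  smul g z := match g with
    | .r j => ⟨ZMod.stdAddChar j * z.1, by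
        obtain ⟨k, hk⟩ := z.2
        exact ⟨j + k, by rw [AddChar.map_add_eq_mul, hk]⟩⟩
    | .sr j => ⟨(starRingEnd ℂ) (ZMod.stdAddChar j * z.1), by
        obtain ⟨k, hk⟩ := z.2
        exact ⟨-(j + k), by
          rw [AddChar.map_neg_eq_conj, AddChar.map_add_eq_mul, hk]⟩⟩
  one_smul z := Subtype.ext (by
    change ZMod.stdAddChar (0 : ZMod n) * z.1 = z.1
    simp)
  mul_smul g h z := Subtype.ext (by
    rcases g with i | i <;> rcases h with j | j
    · change ZMod.stdAddChar (i + j) * z.1 = ZMod.stdAddChar i * (ZMod.stdAddChar j * z.1)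
      rw [AddChar.map_add_eq_mul, mul_assoc]
    · change (starRingEnd ℂ) (ZMod.stdAddChar (j - i) * z.1) =
        ZMod.stdAddChar i * (starRingEnd ℂ) (ZMod.stdAddChar j * z.1)
      rw [sub_eq_add_neg, AddChar.map_add_eq_mul, AddChar.map_neg_eq_conj]
      simp only [map_mul, Complex.conj_conj]
      ring
    · change (starRingEnd ℂ) (ZMod.stdAddChar (i + j) * z.1) =
        (starRingEnd ℂ) (ZMod.stdAddChar i * (ZMod.stdAddChar j * z.1))
      rw [AddChar.map_add_eq_mul, mul_assoc]
    · change ZMod.stdAddChar (j - i) * z.1 =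
        (starRingEnd ℂ) (ZMod.stdAddChar i * (starRingEnd ℂ) (ZMod.stdAddChar j * z.1))
      rw [sub_eq_add_neg, AddChar.map_add_eq_mul, AddChar.map_neg_eq_conj]
      simp only [map_mul, Complex.conj_conj]
      ring)

/-- The vertices of the regular `n`-gon form a `D_n`-set isomorphic to `D_n / D_1`. -/
theorem polygonVertex_gIsomorphic (n : ℕ) [NeZero n] :
    GIsomorphic (DihedralGroup n) (PolygonVertex n) (DihedralGroup n ⧸ dihedralD1 n) := by
  let v : PolygonVertex n := ⟨1, 0, by simp⟩
  have hr : ∀ j : ZMod n, ((DihedralGroup.r j • v).1 : ℂ) = ZMod.stdAddChar j := fun j =>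
    mul_one _
  have hs : ∀ j : ZMod n, ((DihedralGroup.sr j • v).1 : ℂ) = ZMod.stdAddChar (-j) := fun j => by
    rw [AddChar.map_neg_eq_conj]
    exact congrArg (starRingEnd ℂ) (mul_one _)
  have h1 : ∀ j : ZMod n, (ZMod.stdAddChar j : ℂ) = 1 → j = 0 := fun j hj =>
    ZMod.injective_stdAddChar (hj.trans (by simp))
  have hst : MulAction.stabilizer (DihedralGroup n) v = dihedralD1 n := by
    ext g
    rw [MulAction.mem_stabilizer_iff]
    constructor
    · intro hg
      have hg' := congrArg Subtype.val hg
      rcases g with j | j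
      · rw [hr] at hg'
        rw [h1 j hg']
        exact (dihedralD1 n).one_mem
      · rw [hs] at hg'
        rw [neg_eq_zero.mp (h1 _ hg')]
        exact Subgroup.mem_zpowers _
    · intro hg
      have : dihedralD1 n ≤ MulAction.stabilizer (DihedralGroup n) v := by
        refine Subgroup.zpowers_le.mpr (MulAction.mem_stabilizer_iff.mpr (Subtype.ext ?_))
        rw [hs]
        simp [v]
      exact MulAction.mem_stabilizer_iff.mp (this hg)
  have htr : MulAction.orbit (DihedralGroup n) v = Set.univ := by
    refine Set.eq_univ_of_forall fun z => ?_
    obtain ⟨j, hj⟩ := z.2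
    exact ⟨DihedralGroup.r j, Subtype.ext ((hr j).trans hj)⟩
  rw [← hst]
  let e := MulAction.orbitEquivQuotientStabilizer (DihedralGroup n) v
  let u : PolygonVertex n ≃ MulAction.orbit (DihedralGroup n) v :=
    (Equiv.Set.univ _).symm.trans (Equiv.setCongr htr.symm)
  refine ⟨u.trans e, fun g s => ?_⟩
  apply (u.trans e).symm.injective
  rw [Equiv.symm_apply_apply]
  obtain ⟨q, rfl⟩ := (u.trans e).symm.surjective s
  rw [Equiv.apply_symm_apply]
  induction q using QuotientGroup.induction_on with
  | H h =>
    have key : ∀ k : DihedralGroup n, (u.trans e).symm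
        (k : DihedralGroup n ⧸ MulAction.stabilizer (DihedralGroup n) v) = k • v := fun k =>
      MulAction.orbitEquivQuotientStabilizer_symm_apply (DihedralGroup n) v k
    rw [key h]
    change g • h • v = (u.trans e).symm ((g * h : DihedralGroup n) :
      DihedralGroup n ⧸ MulAction.stabilizer (DihedralGroup n) v)
    rw [key, mul_smul]

/-! ### Necklace polynomials -/

/-- The necklace polynomial `M(k,n) = (1/n) ∑_{d ∣ n} μ(n/d) k ^ d`, as a function of a
real variable `k`. -/
noncomputable def necklaceM (k : ℝ) (n : ℕ) : ℝ :=
  (1 / (n : ℝ)) * ∑ d ∈ n.divisors, (ArithmeticFunction.moebius (n / d) : ℝ) * k ^ d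

/-- The power series `1 + |A'| t ^ i`, where `A' = A \ {a}`. -/
noncomputable def colorFactor {A : Type*} (a : A) (i : ℕ) : PowerSeries ℚ :=
  1 + (Nat.card {x : A // x ≠ a} : PowerSeries ℚ) * PowerSeries.X ^ i

/-- `μ(m)`, as a constant power series. -/
noncomputable def moebiusConst (m : ℕ) : PowerSeries ℚ :=
  PowerSeries.C (ArithmeticFunction.moebius m : ℚ)

/-!
# Chiral words and the orbits of the dihedral group on nested colourings

In coordinates (`exists_equiv_zmod`) the `D_n`-set `X` is `ZMod n`, with `r i` acting as `x ↦ i + x`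
and `sr i` as `x ↦ -(i + x)`; the two kinds of letters of `J` together are just the colours `A`
(`nestedColorEquiv`), the level being `0` for `a` and `1` otherwise. So `J` is the set of words
`ZMod n → A`, graded by the number of letters other than `a`. As `C_{n/d} = ⟨r ^ d⟩` is normal of
index `2 d`, the number of orbits isomorphic to `D_n / C_{n/d}` is `1 / (2 d)` times the number of
words with stabilizer `C_{n/d}` (`orbitCount_mul_index`), that is, of words of period exactly `d`
that no reflection leaves invariant (`IsChiralWord`). For `d = n` these are the primitive colourings.

The chiral words are counted with a weight, a product over the letters with values in a domain `K` of
characteristic zero. A letter weighs `1` or `t` in `ℚ⟦t⟧` for the graded count and `1` in `ℝ` for the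
plain one, so that both are instances of `two_mul_sum_chiral`. Write `p m` for the sum over the
letters of the `m`-th powers of the weights.

* Words of period dividing `e` are words on `ZMod e` with each letter repeated `n / e` times. Their
  total weight is `p (n / e) ^ e`, and Möbius inversion gives the weight `N d` of the words of
  period `d`.
* Let `P c` be the weight of the words of period `c` that some reflection leaves invariant. The
  reflections leaving such a word invariant form a coset of `⟨r ^ c⟩` and number `n / c`, so the sum
  of `(n / c) P c` over `c ∣ e` is the sum over all reflections of the weights of the invariant
  words of period dividing `e` (`sum_divisors_palindromic`). A reflection with `k` fixed points on
  `ZMod e` contributes `p (n / e) ^ k * p (2 n / e) ^ ((e - k) / 2)`, where `k = 1` for odd `e`, and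
  `k` is `2` or `0` equally often for even `e`. This sum is `n / 2` times `palindromeWeight`, and a
  second Möbius inversion gives `P d`.

The weight of the chiral words is `N d - P d`. The three cases differ in the contribution of
the odd `e`: all `e` are odd when `d` is; for `d = 2 m` with `m` odd the divisors of `d` pair up as
`e`, `2 e` with opposite Möbius values (`sum_moebius_two_mul`); for `4 ∣ d` the odd `e` have
`μ (d / e) = 0`.
-/

section Words
open Finset
open scoped Classical

variable {K : Type*} [CommRing K] {B : Type*}

/-! ### Words that factor through a quotient -/

/-- The power sum `∑ w(b) ^ m` over all letters `b`. -/
def powerSum [Fintype B] (w : B → K) (m : ℕ) : K := ∑ b, w b ^ m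

lemma powerSum_pow [Fintype B] (w : B → K) (m k : ℕ) :
    powerSum (fun b => w b ^ m) k = powerSum w (m * k) := by
  simp [powerSum, pow_mul]

/-- The maps that factor through `π : Y → Z` contribute, to the sum of products of weights, as the
maps on `Z` whose weights are raised to the sizes of the fibres of `π`. -/
lemma sum_filter_prod_comp [Fintype B] {Y Z : Type*} [Fintype Y] [Fintype Z] [DecidableEq Y]
    [DecidableEq Z] {π : Y → Z}
    (hπ : Function.Surjective π) (w : B → K) {p : (Y → B) → Prop} {q : (Z → B) → Prop}
    [DecidablePred p] [DecidablePred q] (h : ∀ f, p f ↔ ∃ g, q g ∧ g ∘ π = f) :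
    ∑ f : Y → B with p f, ∏ y, w (f y) =
      ∑ g : Z → B with q g, ∏ z, w (g z) ^ #{y | π y = z} := by
  have himg : (univ.filter p) = (univ.filter q).image (fun g => g ∘ π) := by
    ext f; simp [h]
  rw [himg, sum_image fun g _ g' _ hg => hπ.injective_comp_right hg]
  refine sum_congr rfl fun g _ => ?_
  refine (Fintype.prod_fiberwise' π (fun z => w (g z))).symm.trans ?_
  refine prod_congr rfl fun z _ => ?_
  simp [Fintype.card_subtype]

lemma sum_prod_pow [Fintype B] {Z : Type*} [Fintype Z] [DecidableEq Z] (w : B → K) (c : Z → ℕ) :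
    ∑ g : Z → B, ∏ z, w (g z) ^ c z = ∏ z, powerSum w (c z) := by
  simp only [powerSum]
  rw [prod_univ_sum (fun _ => univ) (fun z b => w b ^ c z), Fintype.piFinset_univ]

/-! ### Words invariant under an involution -/

/-- The equivalence relation whose classes are the orbits of an involution. -/
def involutionSetoid {Y : Type*} (σ : Y → Y) (hσ : Function.Involutive σ) : Setoid Y where
  r y z := z = y ∨ z = σ y
  iseqv :=
    { refl := fun _ => Or.inl rfl
      symm := by
        rintro y z (rfl | rfl)
        · exact Or.inl rfl
        · exact Or.inr (hσ y).symm
      trans := by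
        rintro x y z (rfl | rfl) (rfl | rfl)
        · exact Or.inl rfl
        · exact Or.inr rfl
        · exact Or.inr rfl
        · exact Or.inl (hσ x) }

/-- Each fixed point of the involution contributes a free letter of weight `w`, each orbit of
size two a free letter of weight `w ^ 2`. -/
lemma sum_prod_involution [Fintype B] {Y : Type*} [Fintype Y] [DecidableEq Y]
    (σ : Y → Y) (hσ : Function.Involutive σ) (w : B → K) :
    ∑ f : Y → B with (∀ y, f (σ y) = f y), ∏ y, w (f y) =
      powerSum w 1 ^ #{y | σ y = y} *
        powerSum w 2 ^ ((Fintype.card Y - #{y | σ y = y}) / 2) := by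
  let s := involutionSetoid σ hσ
  let π : Y → Quotient s := Quotient.mk s
  have hmk : ∀ y z, π z = π y ↔ z = y ∨ z = σ y := fun y z =>
    (eq_comm.trans Quotient.eq : π z = π y ↔ s y z)
  have hfib : ∀ y, ({z | π z = π y} : Finset Y) = {y, σ y} := by
    intro y; ext z; simp [hmk]
  have hcard : ∀ y, #{z | π z = π y} = if σ y = y then 1 else 2 := by
    intro y
    rw [hfib]
    split_ifs with hy
    · simp [hy]
    · exact card_pair (Ne.symm hy)
  have h12 : ∀ q : Quotient s, #{z | π z = q} = 1 ∨ #{z | π z = q} = 2 := by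
    intro q
    obtain ⟨y, rfl⟩ := Quotient.exists_rep q
    have := hcard y
    change #{z | π z = π y} = 1 ∨ #{z | π z = π y} = 2
    rw [this]; split_ifs <;> simp
  rw [sum_filter_prod_comp (π := π) Quotient.mk_surjective w (q := fun _ => True)]
  · rw [filter_true, sum_prod_pow]
    have hfix : #{y | σ y = y} = #{q : Quotient s | #{z | π z = q} = 1} := by
      refine card_bij (fun y _ => π y) ?_ ?_ ?_
      · intro y hy
        simp only [mem_filter, mem_univ, true_and] at hy ⊢
        rw [hcard, if_pos hy]
      · intro y hy z hz hyz
        simp only [mem_filter, mem_univ, true_and] at hy hz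
        rcases (hmk _ _).1 hyz with h | h
        · exact h
        · rw [h, hz]
      · intro q hq
        obtain ⟨y, rfl⟩ := Quotient.exists_rep q
        refine ⟨y, ?_, rfl⟩
        simp only [mem_filter, mem_univ, true_and] at hq ⊢
        by_contra hne
        have h2 := hcard y
        rw [if_neg hne] at h2
        exact absurd (hq.symm.trans h2) (by decide)
    -- The classes of size one are the fixed points, so the others number half of the remaining
    -- points.
    have htot : Fintype.card Y = #{q : Quotient s | #{z | π z = q} = 1} +
        2 * #{q : Quotient s | ¬ #{z | π z = q} = 1} := by
      rw [← card_univ, card_eq_sum_card_fiberwise (f := π) (t := univ) (by simp),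
        ← sum_filter_add_sum_filter_not univ (fun q => #{z | π z = q} = 1)]
      congr 1
      · rw [sum_congr rfl (g := fun _ => 1) (by simp)]; simp
      · rw [sum_congr rfl (g := fun _ => 2)]
        · simp [mul_comm]
        · intro q hq
          exact (h12 q).resolve_left (by simpa using hq)
    have h1 : ∏ q with #{z | π z = q} = 1, powerSum w #{z | π z = q} =
        powerSum w 1 ^ #{q | #{z | π z = q} = 1} := by
      rw [← prod_const]
      exact prod_congr rfl fun q hq => by rw [(mem_filter.1 hq).2]
    have h2 : ∏ q with ¬ #{z | π z = q} = 1, powerSum w #{z | π z = q} =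
        powerSum w 2 ^ #{q | ¬ #{z | π z = q} = 1} := by
      rw [← prod_const]
      exact prod_congr rfl fun q hq => by rw [(h12 q).resolve_left (mem_filter.1 hq).2]
    rw [← prod_filter_mul_prod_filter_not univ (fun q => #{z | π z = q} = 1), h1, h2, hfix, htot,
      Nat.add_sub_cancel_left, Nat.mul_div_cancel_left _ two_pos]
  · intro f
    constructor
    · intro hf
      refine ⟨Quotient.lift f ?_, trivial, rfl⟩
      rintro y z (rfl | rfl)
      · rfl
      · exact (hf y).symm
    · rintro ⟨g, -, rfl⟩ y
      exact congrArg g ((hmk y (σ y)).2 (Or.inr rfl))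

/-! ### Periods of cyclic words -/

variable {n : ℕ}

/-- The smallest `k > 0` with `f (x + k) = f x` for all `x` (and `0` if there is none, which can
happen only for `n = 0`). -/
noncomputable def cyclicPeriod (f : ZMod n → B) : ℕ :=
  Function.minimalPeriod (fun (g : ZMod n → B) x => g (x + 1)) f

lemma cyclicPeriod_dvd_iff (f : ZMod n → B) (k : ℕ) :
    cyclicPeriod f ∣ k ↔ ∀ x, f (x + k) = f x := by
  have hit : ∀ (k : ℕ) (f : ZMod n → B),
      (fun (g : ZMod n → B) x => g (x + 1))^[k] f = fun x => f (x + k) := by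
    intro k
    induction k with
    | zero => intro f; simp
    | succ k ih =>
      intro f
      rw [Function.iterate_succ_apply, ih]
      funext x
      push_cast
      rw [add_assoc]
  rw [cyclicPeriod, ← Function.isPeriodicPt_iff_minimalPeriod_dvd, Function.IsPeriodicPt,
    Function.IsFixedPt, hit, funext_iff]

lemma cyclicPeriod_dvd (f : ZMod n → B) : cyclicPeriod f ∣ n :=
  (cyclicPeriod_dvd_iff f n).2 (by simp)

variable [NeZero n]

lemma cyclicPeriod_dvd_val_iff (f : ZMod n → B) (i : ZMod n) :
    cyclicPeriod f ∣ i.val ↔ ∀ x, f (i + x) = f x := by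
  simp [cyclicPeriod_dvd_iff, add_comm]

lemma castHom_eq_zero_iff {e : ℕ} (he : e ∣ n) (i : ZMod n) :
    ZMod.castHom he (ZMod e) i = 0 ↔ e ∣ i.val := by
  rw [ZMod.castHom_apply, ← ZMod.natCast_val, ZMod.natCast_eq_zero_iff]

lemma card_castHom_fiber {e : ℕ} (he : e ∣ n) (y : ZMod e) :
    #{i : ZMod n | ZMod.castHom he (ZMod e) i = y} = n / e := by
  have : NeZero e := ⟨fun h => NeZero.ne n (Nat.eq_zero_of_zero_dvd (h ▸ he))⟩
  have hsurj := ZMod.castHom_surjective he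
  have h := card_eq_sum_card_fiberwise (f := ZMod.castHom he (ZMod e)) (s := univ) (t := univ)
    (by simp)
  rw [sum_congr rfl (g := fun _ => #{i : ZMod n | ZMod.castHom he (ZMod e) i = y})] at h
  · rw [card_univ, sum_const, card_univ, ZMod.card, ZMod.card, smul_eq_mul] at h
    exact (Nat.div_eq_of_eq_mul_right (NeZero.pos e) h).symm
  · exact fun z _ => AddMonoidHom.card_fiber_eq_of_mem_range
      (ZMod.castHom he (ZMod e)) (hsurj z) (hsurj y)

lemma cyclicPeriod_dvd_iff_exists_comp {e : ℕ} (he : e ∣ n) (f : ZMod n → B) :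
    cyclicPeriod f ∣ e ↔ ∃ g : ZMod e → B, g ∘ ZMod.castHom he (ZMod e) = f := by
  constructor
  · intro h
    refine ⟨fun y => f (Function.surjInv (ZMod.castHom_surjective he) y), funext fun x => ?_⟩
    set x' := Function.surjInv (ZMod.castHom_surjective he) (ZMod.castHom he (ZMod e) x)
    have hx' : ZMod.castHom he (ZMod e) x' = ZMod.castHom he (ZMod e) x :=
      Function.surjInv_eq (ZMod.castHom_surjective he) _
    have hd : e ∣ (x' - x).val := by
      rw [← castHom_eq_zero_iff he, map_sub, hx', sub_self]
    have := (cyclicPeriod_dvd_val_iff f _).1 (h.trans hd) x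
    rwa [sub_add_cancel] at this
  · rintro ⟨g, rfl⟩
    rw [cyclicPeriod_dvd_iff]
    intro x
    simp only [Function.comp_apply, map_add, map_natCast, CharP.cast_eq_zero, add_zero]

/-- The words of period dividing `e` are the words on `ZMod e`, with letters repeated `n / e`
times. -/
lemma sum_cyclicPeriod_dvd [Fintype B] {e : ℕ} (he : e ∣ n) (w : B → K) :
    ∑ f : ZMod n → B with cyclicPeriod f ∣ e, ∏ x, w (f x) = powerSum w (n / e) ^ e := by
  have : NeZero e := ⟨fun h => NeZero.ne n (Nat.eq_zero_of_zero_dvd (h ▸ he))⟩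
  rw [sum_filter_prod_comp (ZMod.castHom_surjective he) w (q := fun _ => True)]
  · simp only [card_castHom_fiber, filter_true]
    rw [sum_prod_pow]
    simp
  · intro f
    simp [cyclicPeriod_dvd_iff_exists_comp he]

/-! ### Palindromic words -/

/-- The word `f` is invariant under the reflection `x ↦ -(j + x)` of `ZMod n`. -/
def ReflectionInvariant (j : ZMod n) (f : ZMod n → B) : Prop := ∀ x, f (-(j + x)) = f x

/-- The words of period dividing `e` that are invariant under a given reflection of `ZMod n` are
the words on `ZMod e` invariant under the reflection it induces. -/
lemma sum_reflectionInvariant [Fintype B] {e : ℕ} [NeZero e] (he : e ∣ n) (w : B → K) (j : ZMod n) :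
    ∑ f : ZMod n → B with (cyclicPeriod f ∣ e ∧ ReflectionInvariant j f), ∏ x, w (f x) =
      powerSum w (n / e) ^ #{y : ZMod e | -(ZMod.castHom he (ZMod e) j + y) = y} *
        powerSum w (n / e * 2) ^
          ((e - #{y : ZMod e | -(ZMod.castHom he (ZMod e) j + y) = y}) / 2) := by
  have hsurj := ZMod.castHom_surjective he
  rw [sum_filter_prod_comp hsurj w
    (q := fun g => ∀ y, g (-(ZMod.castHom he (ZMod e) j + y)) = g y)]
  · simp only [card_castHom_fiber]
    rw [sum_prod_involution (fun y => -(ZMod.castHom he (ZMod e) j + y))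
      (fun y => by ring) (fun b => w b ^ (n / e)), powerSum_pow, powerSum_pow, ZMod.card, mul_one]
  · intro f
    rw [cyclicPeriod_dvd_iff_exists_comp he]
    constructor
    · rintro ⟨⟨g, rfl⟩, h⟩
      refine ⟨g, fun y => ?_, rfl⟩
      obtain ⟨x, rfl⟩ := hsurj y
      simpa only [Function.comp_apply, map_neg, map_add] using h x
    · rintro ⟨g, h, rfl⟩
      refine ⟨⟨g, rfl⟩, fun x => ?_⟩
      simpa only [Function.comp_apply, map_neg, map_add] using h (ZMod.castHom he (ZMod e) x)

lemma neg_add_eq_self_iff {R : Type*} [CommRing R] (j y : R) : -(j + y) = y ↔ y + y = -j := by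
  constructor <;> intro h
  · linear_combination -h
  · linear_combination -h

lemma card_reflection_fixed_of_odd {e : ℕ} [NeZero e] (h : ¬ 2 ∣ e) (j : ZMod e) :
    #{y : ZMod e | -(j + y) = y} = 1 := by
  have hu : IsUnit (2 : ZMod e) := by
    have := (ZMod.isUnit_iff_coprime 2 e).2 ((Nat.Prime.coprime_iff_not_dvd Nat.prime_two).2 h)
    simpa using this
  obtain ⟨u, hu⟩ := hu
  rw [card_eq_one]
  refine ⟨-(↑u⁻¹ * j), ?_⟩
  ext y
  simp only [mem_filter, mem_univ, true_and, mem_singleton, neg_add_eq_self_iff]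
  rw [← two_mul, ← hu, ← Units.eq_inv_mul_iff_mul_eq, mul_neg]

lemma card_add_self_eq_zero {e : ℕ} [NeZero e] (h : 2 ∣ e) : #{y : ZMod e | y + y = 0} = 2 := by
  obtain ⟨m, rfl⟩ := h
  have hm : 0 < m := Nat.pos_of_ne_zero fun h => NeZero.ne (2 * m) (by simp [h])
  have hval : ((m : ZMod (2 * m))).val = m := by
    rw [ZMod.val_natCast, Nat.mod_eq_of_lt (by omega)]
  rw [card_eq_two]
  refine ⟨0, (m : ZMod (2 * m)), ?_, ?_⟩
  · intro h0
    rw [← h0, ZMod.val_zero] at hval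
    omega
  · ext y
    simp only [mem_filter, mem_univ, true_and, mem_insert, mem_singleton]
    rw [← eq_neg_iff_add_eq_zero, eq_comm, ZMod.neg_eq_self_iff]
    refine or_congr Iff.rfl ⟨fun hy => ?_, fun hy => ?_⟩
    · apply ZMod.val_injective
      rw [hval]; omega
    · rw [hy, hval]

/-- For even `e`, half of the reflections of `ZMod e` have two fixed points and the others none:
the fixed points solve `2 y = -j`. -/
lemma sum_reflection_fixed_of_even {e : ℕ} [NeZero e] (h : 2 ∣ e) (φ : ℕ → K) :
    2 * ∑ j : ZMod e, φ #{y : ZMod e | -(j + y) = y} = e * (φ 2 + φ 0) := by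
  let D : ZMod e →+ ZMod e := -(AddMonoidHom.id _ + AddMonoidHom.id _)
  have hD : ∀ y, D y = -(y + y) := fun y => rfl
  have hfib : ∀ j, ({y : ZMod e | -(j + y) = y} : Finset _) = ({y | D y = j} : Finset _) := by
    intro j; ext y
    simp only [mem_filter, mem_univ, true_and, neg_add_eq_self_iff, hD]
    rw [neg_eq_iff_eq_neg]
  simp only [hfib]
  have hin : ∀ j ∈ Set.range D, #{y | D y = j} = 2 := by
    intro j hj
    rw [AddMonoidHom.card_fiber_eq_of_mem_range D hj ⟨0, map_zero D⟩, ← card_add_self_eq_zero h]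
    simp only [hD, neg_eq_zero]
  have hout : ∀ j, j ∉ Set.range D → #{y | D y = j} = 0 := by
    intro j hj
    rw [card_eq_zero, filter_eq_empty_iff]
    exact fun y _ hy => hj ⟨y, hy⟩
  have hite : ∀ j, #{y | D y = j} = if j ∈ Set.range D then 2 else 0 := by
    intro j
    split_ifs with hj
    · exact hin j hj
    · exact hout j hj
  -- Counting the elements of `ZMod e` by their images shows that half of the `j` are images.
  have hN : e = 2 * #{j | j ∈ Set.range D} := by
    have := card_eq_sum_card_fiberwise (f := D) (s := univ) (t := univ) (by simp)
    rw [card_univ, ZMod.card] at this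
    refine this.trans ?_
    simp only [hite]
    rw [sum_ite, sum_const, sum_const]
    simp [mul_comm]
  have hN' := card_filter_add_card_filter_not (s := (univ : Finset (ZMod e)))
    (fun j => j ∈ Set.range D)
  rw [card_univ, ZMod.card] at hN'
  have hN2 : #{j | ¬ j ∈ Set.range D} = #{j | j ∈ Set.range D} := by omega
  simp only [hite, apply_ite φ]
  rw [sum_ite, sum_const, sum_const, hN2]
  conv_rhs => rw [hN]
  rw [nsmul_eq_mul, nsmul_eq_mul]
  push_cast
  ring

/-- If one reflection leaves `f` invariant, another does so iff the rotation that is their product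
does. So the reflections leaving `f` invariant, if any, form a coset of the rotations doing so. -/
lemma card_reflectionInvariant {f : ZMod n → B} (h : ∃ j, ReflectionInvariant j f) :
    #{j | ReflectionInvariant j f} = n / cyclicPeriod f := by
  obtain ⟨j₀, h₀⟩ := h
  rw [← card_castHom_fiber (cyclicPeriod_dvd f)
    (ZMod.castHom (cyclicPeriod_dvd f) (ZMod (cyclicPeriod f)) j₀)]
  congr 1
  ext j
  simp only [mem_filter, mem_univ, true_and]
  rw [← sub_eq_zero, ← map_sub, castHom_eq_zero_iff, cyclicPeriod_dvd_val_iff]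
  refine forall_congr' fun x => ?_
  rw [← h₀ (j - j₀ + x)]
  ring_nf

/-- Twice the average, over the reflections of `ZMod n`, of the weight of the words of period
dividing `e` that are invariant under the reflection. -/
def palindromeWeight [Fintype B] (n : ℕ) (w : B → K) (e : ℕ) : K :=
  if 2 ∣ e then
    powerSum w (n / e) ^ 2 * powerSum w (n / e * 2) ^ (e / 2 - 1) + powerSum w (n / e * 2) ^ (e / 2)
  else 2 * (powerSum w (n / e) * powerSum w (n / e * 2) ^ ((e - 1) / 2))

lemma sum_sum_reflectionInvariant [Fintype B] {e : ℕ} (he : e ∣ n) (w : B → K) :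
    2 * ∑ j : ZMod n, ∑ f : ZMod n → B with (cyclicPeriod f ∣ e ∧ ReflectionInvariant j f),
      ∏ x, w (f x) = n * palindromeWeight n w e := by
  have : NeZero e := ⟨fun h => NeZero.ne n (Nat.eq_zero_of_zero_dvd (h ▸ he))⟩
  have hn : (n : K) = (n / e : ℕ) * e := by
    rw [← Nat.cast_mul, Nat.div_mul_cancel he]
  simp only [sum_reflectionInvariant he]
  set φ : ℕ → K := fun k => powerSum w (n / e) ^ k * powerSum w (n / e * 2) ^ ((e - k) / 2)
    with hφ
  have hfib : ∑ j : ZMod n, φ #{y : ZMod e | -(ZMod.castHom he (ZMod e) j + y) = y} =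
      (n / e : ℕ) * ∑ k : ZMod e, φ #{y : ZMod e | -(k + y) = y} := by
    rw [← sum_fiberwise' univ (ZMod.castHom he (ZMod e))
      (fun k => φ #{y : ZMod e | -(k + y) = y}), mul_sum]
    refine sum_congr rfl fun k _ => ?_
    rw [sum_const, card_castHom_fiber, nsmul_eq_mul]
  refine (congrArg (2 * ·) hfib).trans ?_
  rw [mul_left_comm, hn, mul_assoc, palindromeWeight]
  congr 1
  split_ifs with h2
  · rw [sum_reflection_fixed_of_even h2, hφ]
    simp only [pow_zero, one_mul, Nat.sub_zero]
    rw [show (e - 2) / 2 = e / 2 - 1 by omega]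
  · simp only [card_reflection_fixed_of_odd h2]
    simp [hφ, mul_left_comm]

/-- A word of period `c` that is invariant under some reflection is so under `n / c` of them. -/
lemma sum_divisors_palindromic [Fintype B] {e : ℕ} (he : e ∣ n) (w : B → K) :
    ∑ c ∈ e.divisors, (n / c : ℕ) * ∑ f : ZMod n → B with
        (cyclicPeriod f = c ∧ ∃ j, ReflectionInvariant j f), ∏ x, w (f x) =
      ∑ j : ZMod n, ∑ f : ZMod n → B with (cyclicPeriod f ∣ e ∧ ReflectionInvariant j f),
        ∏ x, w (f x) := by
  have he0 : e ≠ 0 := fun h => NeZero.ne n (Nat.eq_zero_of_zero_dvd (h ▸ he))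
  have hr : ∑ j : ZMod n, ∑ f : ZMod n → B with (cyclicPeriod f ∣ e ∧ ReflectionInvariant j f),
        ∏ x, w (f x) =
      ∑ f : ZMod n → B with (cyclicPeriod f ∣ e ∧ ∃ j, ReflectionInvariant j f),
        ((n / cyclicPeriod f : ℕ) : K) * ∏ x, w (f x) := by
    rw [sum_filter]
    simp only [sum_filter (fun f : ZMod n → B => cyclicPeriod f ∣ e ∧ ReflectionInvariant _ f)]
    rw [sum_comm]
    refine sum_congr rfl fun f _ => ?_
    by_cases hf : cyclicPeriod f ∣ e
    · by_cases hj : ∃ j, ReflectionInvariant j f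
      · rw [if_pos ⟨hf, hj⟩, ← card_reflectionInvariant hj, ← nsmul_eq_mul, ← sum_const,
          sum_filter]
        exact sum_congr rfl fun j _ => by simp [hf]
      · rw [if_neg fun h => hj h.2]
        exact sum_eq_zero fun j _ => if_neg fun h => hj ⟨j, h.2⟩
    · simp [hf]
  rw [hr, ← sum_fiberwise_of_maps_to (s := univ.filter _) (t := e.divisors) (g := cyclicPeriod)
    (fun f hf => Nat.mem_divisors.2 ⟨(mem_filter.1 hf).2.1, he0⟩)]
  refine sum_congr rfl fun c hc => ?_
  rw [mul_sum, filter_filter]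
  refine sum_congr ?_ fun f hf => ?_
  · ext f
    simp only [mem_filter, mem_univ, true_and]
    constructor
    · rintro ⟨rfl, h⟩
      exact ⟨⟨Nat.dvd_of_mem_divisors hc, h⟩, rfl⟩
    · rintro ⟨⟨-, h⟩, rfl⟩
      exact ⟨rfl, h⟩
  · rw [(mem_filter.1 hf).2.2]

lemma sum_divisors_cyclicPeriod [Fintype B] {e : ℕ} (he : e ∣ n) (w : B → K) :
    ∑ c ∈ e.divisors, ∑ f : ZMod n → B with cyclicPeriod f = c, ∏ x, w (f x) =
      powerSum w (n / e) ^ e := by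
  have he0 : e ≠ 0 := fun h => NeZero.ne n (Nat.eq_zero_of_zero_dvd (h ▸ he))
  rw [← sum_cyclicPeriod_dvd he, ← sum_fiberwise_of_maps_to (s := univ.filter _)
    (t := e.divisors) (g := cyclicPeriod)
    (fun f hf => Nat.mem_divisors.2 ⟨(mem_filter.1 hf).2, he0⟩)]
  refine sum_congr rfl fun c hc => ?_
  rw [filter_filter]
  refine sum_congr ?_ fun _ _ => rfl
  ext f
  simp only [mem_filter, mem_univ, true_and]
  exact ⟨fun h => ⟨h ▸ Nat.dvd_of_mem_divisors hc, h⟩, fun h => h.2⟩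

/-! ### Möbius inversion over the periods -/

/-- Möbius inversion on the divisors of `n`. -/
lemma eq_sum_moebius_of_dvd {n : ℕ} [NeZero n] {F G : ℕ → K}
    (h : ∀ e, e ∣ n → ∑ c ∈ e.divisors, F c = G e) {d : ℕ} (hd : d ∣ n) :
    F d = ∑ e ∈ d.divisors, (ArithmeticFunction.moebius (d / e) : K) * G e := by
  rw [← (ArithmeticFunction.sum_eq_iff_sum_mul_moebius_eq_on {m | m ∣ n}
    (fun _ _ h h' => h.trans h')).1 (fun e _ he => h e he) d
      (Nat.pos_of_dvd_of_pos hd (NeZero.pos n)) hd,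
    Nat.sum_divisorsAntidiagonal' (fun x y => (ArithmeticFunction.moebius x : K) * G y)]

/-- The word `f` has period exactly `d` and is invariant under no reflection. -/
def IsChiralWord (d : ℕ) (f : ZMod n → B) : Prop :=
  cyclicPeriod f = d ∧ ¬ ∃ j, ReflectionInvariant j f

lemma isChiralWord_comp_iff {n : ℕ} {C : Type*} {u : B → C} (hu : Function.Injective u) (d : ℕ)
    (f : ZMod n → B) : IsChiralWord d (u ∘ f) ↔ IsChiralWord d f := by
  have hp : cyclicPeriod (u ∘ f) = cyclicPeriod f := by
    have h : ∀ k, cyclicPeriod (u ∘ f) ∣ k ↔ cyclicPeriod f ∣ k := by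
      intro k
      simp [cyclicPeriod_dvd_iff, hu.eq_iff]
    exact Nat.dvd_antisymm ((h _).2 dvd_rfl) ((h _).1 dvd_rfl)
  simp [IsChiralWord, ReflectionInvariant, hp, hu.eq_iff]

/-- The chiral words of period `d`: those of period `d` minus the palindromic ones, both evaluated
by Möbius inversion. -/
theorem two_mul_sum_chiral [Fintype B] [IsDomain K] [CharZero K] {d : ℕ}
    (hd : d ∣ n) (w : B → K) :
    2 * ∑ f : ZMod n → B with IsChiralWord d f, ∏ x, w (f x) =
      ∑ e ∈ d.divisors, (ArithmeticFunction.moebius (d / e) : K) *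
        (2 * powerSum w (n / e) ^ e - d * palindromeWeight n w e) := by
  have hN := eq_sum_moebius_of_dvd (fun e he => sum_divisors_cyclicPeriod he w) hd
  have hP := eq_sum_moebius_of_dvd (fun e he => sum_divisors_palindromic he w) hd
  have hP' : 2 * ∑ f : ZMod n → B with (cyclicPeriod f = d ∧ ∃ j, ReflectionInvariant j f),
      ∏ x, w (f x) = d * ∑ e ∈ d.divisors,
        (ArithmeticFunction.moebius (d / e) : K) * palindromeWeight n w e := by
    -- Multiplying by `n = (n / d) * d` produces the factor `n / d` with which the inversion
    -- formula `hP` counts the palindromic words of period `d`.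
    refine mul_left_cancel₀ (Nat.cast_ne_zero.2 (NeZero.ne n) : (n : K) ≠ 0) ?_
    have hn : (n : K) = (n / d : ℕ) * d := by rw [← Nat.cast_mul, Nat.div_mul_cancel hd]
    calc _ = 2 * d * ((n / d : ℕ) * ∑ f : ZMod n → B with
          (cyclicPeriod f = d ∧ ∃ j, ReflectionInvariant j f), ∏ x, w (f x)) := by
            rw [hn]; ring
      _ = d * ∑ e ∈ d.divisors, (ArithmeticFunction.moebius (d / e) : K) *
            (n * palindromeWeight n w e) := by
          rw [hP, mul_comm 2 (d : K), mul_assoc, mul_sum]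
          congr 1
          refine sum_congr rfl fun e he => ?_
          rw [← sum_sum_reflectionInvariant ((Nat.dvd_of_mem_divisors he).trans hd)]
          ring
      _ = _ := by
          rw [mul_sum, mul_sum, mul_sum]
          exact sum_congr rfl fun e _ => by ring
  have hsplit := sum_filter_add_sum_filter_not
    (univ.filter fun f : ZMod n → B => cyclicPeriod f = d)
    (fun f => ∃ j, ReflectionInvariant j f) (fun f => ∏ x, w (f x))
  rw [filter_filter, filter_filter, hN] at hsplit
  have hchiral : (univ.filter fun f : ZMod n → B => IsChiralWord d f) =
      univ.filter fun f => cyclicPeriod f = d ∧ ¬ ∃ j, ReflectionInvariant j f :=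
    filter_congr fun _ _ => Iff.rfl
  rw [hchiral]
  simp only [mul_sub, sum_sub_distrib]
  calc _ = 2 * ∑ e ∈ d.divisors, (ArithmeticFunction.moebius (d / e) : K) *
          powerSum w (n / e) ^ e - d * ∑ e ∈ d.divisors,
        (ArithmeticFunction.moebius (d / e) : K) * palindromeWeight n w e := by
        rw [← hP', ← hsplit]; ring
    _ = _ := by
        rw [mul_sum, mul_sum]
        congr 1 <;> exact sum_congr rfl fun e _ => by ring
end Words

section Orbits

/-! ### Counting orbits by stabilizers -/

/-- If all orbits inside an invariant subset have size `m`, counting the subset counts its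
orbits. -/
lemma card_orbits_mul {G S : Type*} [Group G] [MulAction G S] [Finite S] {T : S → Prop}
    (hT : ∀ (g : G) s, T s → T (g • s)) {m : ℕ}
    (hm : ∀ s, T s → Nat.card (MulAction.orbit G s) = m) :
    Nat.card {ω : MulAction.orbitRel.Quotient G S // ∃ s ∈ ω.orbit, T s} * m =
      Nat.card {s // T s} := by
  classical
  let F : {s // T s} → {ω : MulAction.orbitRel.Quotient G S // ∃ s ∈ ω.orbit, T s} :=
    fun s => ⟨Quotient.mk'' s.1, s.1, MulAction.orbitRel.Quotient.mem_orbit.2 rfl, s.2⟩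
  have : Finite (MulAction.orbitRel.Quotient G S) := Quotient.finite _
  have := Fintype.ofFinite {ω : MulAction.orbitRel.Quotient G S // ∃ s ∈ ω.orbit, T s}
  rw [← Nat.card_congr (Equiv.sigmaFiberEquiv F), Nat.card_sigma,
    Finset.sum_congr rfl (g := fun _ => m), Finset.sum_const, smul_eq_mul, Finset.card_univ,
    Nat.card_eq_fintype_card]
  rintro ⟨ω, s, hs, hTs⟩ -
  obtain rfl := MulAction.orbitRel.Quotient.mem_orbit.1 hs
  rw [← hm s hTs]
  refine Nat.card_congr ⟨fun x => ⟨x.1.1, ?_⟩, fun y => ⟨⟨y.1, ?_⟩, ?_⟩, fun _ => rfl, fun _ => rfl⟩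
  · exact MulAction.orbitRel.Quotient.mem_orbit.2 (congrArg Subtype.val x.2)
  · obtain ⟨g, hg⟩ := y.2
    rw [← hg]
    exact hT g s hTs
  · exact Subtype.ext (Quotient.sound' (MulAction.orbitRel_apply.2 y.2))

lemma gIsomorphic_orbit_iff {G S : Type*} [Group G] [MulAction G S] (H : Subgroup G)
    (ω : MulAction.orbitRel.Quotient G S) :
    GIsomorphic G ω.orbit (G ⧸ H) ↔ ∃ s ∈ ω.orbit, MulAction.stabilizer G s = H := by
  constructor
  · rintro ⟨e, he⟩
    refine ⟨e.symm ((1 : G) : G ⧸ H), (e.symm _).2, ?_⟩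
    ext g
    rw [MulAction.mem_stabilizer_iff, ← MulAction.orbitRel.Quotient.orbit.coe_smul,
      Subtype.coe_inj, ← e.apply_eq_iff_eq, he, Equiv.apply_symm_apply]
    change ((g * 1 : G) : G ⧸ H) = ((1 : G) : G ⧸ H) ↔ g ∈ H
    rw [eq_comm, QuotientGroup.eq]
    simp
  · rintro ⟨s, hs, rfl⟩
    obtain rfl := MulAction.orbitRel.Quotient.mem_orbit.1 hs
    let e : MulAction.orbitRel.Quotient.orbit (Quotient.mk'' s : MulAction.orbitRel.Quotient G S) ≃
        G ⧸ MulAction.stabilizer G s := MulAction.orbitEquivQuotientStabilizer G s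
    have he : ∀ g : G, ((e.symm (g : G ⧸ MulAction.stabilizer G s)) : S) = g • s :=
      fun g => MulAction.orbitEquivQuotientStabilizer_symm_apply G s g
    refine ⟨e, fun g x => ?_⟩
    apply e.symm.injective
    obtain ⟨q, rfl⟩ := e.symm.surjective x
    rw [Equiv.symm_apply_apply, Equiv.apply_symm_apply]
    induction q using QuotientGroup.induction_on with
    | H h =>
      apply Subtype.ext
      change g • (e.symm (h : G ⧸ MulAction.stabilizer G s) : S) =
        (e.symm ((g * h : G) : G ⧸ MulAction.stabilizer G s) : S)
      rw [he, he, mul_smul]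

lemma stabilizer_smul_eq_of_normal {G S : Type*} [Group G] [MulAction G S] {H : Subgroup G}
    [H.Normal] {s : S} (g : G) (h : MulAction.stabilizer G s = H) :
    MulAction.stabilizer G (g • s) = H := by
  rw [MulAction.stabilizer_smul_eq_stabilizer_map_conj, h]
  exact Subgroup.Normal.map_conj_eq H g

lemma card_orbit_eq_index {G S : Type*} [Group G] [MulAction G S] {H : Subgroup G} {s : S}
    (h : MulAction.stabilizer G s = H) : Nat.card (MulAction.orbit G s) = H.index := by
  rw [Nat.card_congr (MulAction.orbitEquivQuotientStabilizer G s), h, Subgroup.index]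

/-- For a normal subgroup `H`, the orbits isomorphic to `G / H` consist of the points with
stabilizer `H`. -/
lemma orbitCount_mul_index {G S : Type*} [Group G] [MulAction G S] [Finite S] (H : Subgroup G)
    [H.Normal] : orbitCount H S * H.index = Nat.card {s : S // MulAction.stabilizer G s = H} := by
  rw [← card_orbits_mul (T := fun s : S => MulAction.stabilizer G s = H)
    (fun g _ => stabilizer_smul_eq_of_normal g) (fun _ => card_orbit_eq_index), orbitCount]
  simp only [gIsomorphic_orbit_iff]

lemma isPrimitiveColoring_iff {G X A : Type*} [Group G] [Finite G] [MulAction G X]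
    (f : MapSet X A) : IsPrimitiveColoring G f ↔ MulAction.stabilizer G f = ⊥ := by
  rw [IsPrimitiveColoring, Nat.card_congr (MulAction.orbitEquivQuotientStabilizer G f),
    ← Subgroup.index, ← Subgroup.card_mul_index (MulAction.stabilizer G f),
    ← Subgroup.card_eq_one]
  exact right_eq_mul₀ (Subgroup.index_ne_zero_of_finite (H := MulAction.stabilizer G f))

lemma mem_stabilizer_mapSet {G X A : Type*} [Group G] [MulAction G X] {f : MapSet X A} {g : G} :
    g ∈ MulAction.stabilizer G f ↔ ∀ x, f (g • x) = f x := by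
  rw [← inv_mem_iff, MulAction.mem_stabilizer_iff]
  have h : ∀ x, (g⁻¹ • f) x = f (g • x) := fun x =>
    congrArg (fun g : G => f (g • x)) (inv_inv g)
  exact funext_iff.trans (forall_congr' fun x => by rw [h])

/-! ### Rotation subgroups of the dihedral group -/

variable {n : ℕ}

lemma sr_notMem_dihedralC (d : ℕ) (i : ZMod n) : DihedralGroup.sr i ∉ dihedralC n d := by
  rintro ⟨k, hk⟩
  simp [DihedralGroup.r_zpow] at hk

lemma dihedralC_self : dihedralC n n = ⊥ := by
  rw [dihedralC, CharP.cast_eq_zero, ← DihedralGroup.one_def, Subgroup.zpowers_one_eq_bot]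

variable [NeZero n]

lemma r_mem_dihedralC {d : ℕ} (hd : d ∣ n) (i : ZMod n) :
    DihedralGroup.r i ∈ dihedralC n d ↔ d ∣ i.val := by
  rw [← castHom_eq_zero_iff hd]
  constructor
  · rintro ⟨k, hk⟩
    simp only [DihedralGroup.r_zpow, DihedralGroup.r.injEq] at hk
    rw [← hk, map_mul, map_natCast, CharP.cast_eq_zero, zero_mul]
  · intro h
    obtain ⟨m, hm⟩ := (castHom_eq_zero_iff hd i).1 h
    refine ⟨m, ?_⟩
    simp only [DihedralGroup.r_zpow, DihedralGroup.r.injEq]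
    rw [← ZMod.natCast_zmod_val i, hm]
    push_cast
    rfl

lemma dihedralC_normal {d : ℕ} (hd : d ∣ n) : (dihedralC n d).Normal := by
  refine ⟨fun h hh g => ?_⟩
  rcases h with j | j
  · rw [r_mem_dihedralC hd, ← castHom_eq_zero_iff hd] at hh
    rcases g with i | i
    · simp only [DihedralGroup.r_mul_r, DihedralGroup.inv_r, r_mem_dihedralC hd,
        ← castHom_eq_zero_iff hd, map_add, map_neg, hh]
      ring
    · simp only [DihedralGroup.sr_mul_r, DihedralGroup.inv_sr, DihedralGroup.sr_mul_sr,
        r_mem_dihedralC hd, ← castHom_eq_zero_iff hd, map_add, map_sub, hh]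
      ring
  · exact absurd hh (sr_notMem_dihedralC d j)

lemma dihedralC_index {d : ℕ} (hd : d ∣ n) : (dihedralC n d).index = 2 * d := by
  have h := Subgroup.card_mul_index (dihedralC n d)
  have hpos : 0 < n / d := Nat.div_pos (Nat.le_of_dvd (NeZero.pos n) hd)
    (Nat.pos_of_dvd_of_pos hd (NeZero.pos n))
  rw [dihedralC, Nat.card_zpowers, DihedralGroup.orderOf_r, ZMod.val_natCast, DihedralGroup.nat_card,
    Nat.gcd_comm, ← Nat.gcd_rec, Nat.gcd_eq_right hd] at h
  refine Nat.eq_of_mul_eq_mul_left hpos (h.trans ?_)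
  rw [mul_left_comm, Nat.div_mul_cancel hd]

/-! ### Vertices of the polygon as residues -/

/-- A `D_n`-set isomorphic to `D_n / D_1` is `ZMod n` with `r i` acting as `x ↦ i + x` and `sr i`
as `x ↦ -(i + x)`. -/
lemma exists_equiv_zmod {n : ℕ} {X : Type*} [MulAction (DihedralGroup n) X]
    (hX : GIsomorphic (DihedralGroup n) X (DihedralGroup n ⧸ dihedralD1 n)) :
    ∃ φ : X ≃ ZMod n, (∀ i x, φ (DihedralGroup.r i • x) = i + φ x) ∧
      ∀ i x, φ (DihedralGroup.sr i • x) = -(i + φ x) := by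
  obtain ⟨e, he⟩ := hX
  let x₀ : X := e.symm ((1 : DihedralGroup n) : DihedralGroup n ⧸ dihedralD1 n)
  have hx₀ : ∀ g : DihedralGroup n, e (g • x₀) = (g : DihedralGroup n ⧸ dihedralD1 n) := by
    intro g
    rw [he, Equiv.apply_symm_apply]
    change ((g * 1 : DihedralGroup n) : DihedralGroup n ⧸ dihedralD1 n) = _
    rw [mul_one]
  have hs : DihedralGroup.sr (0 : ZMod n) • x₀ = x₀ := by
    have h1 : e x₀ = ((1 : DihedralGroup n) : DihedralGroup n ⧸ dihedralD1 n) :=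
      e.apply_symm_apply _
    rw [← e.apply_eq_iff_eq, hx₀, h1, eq_comm, QuotientGroup.eq, inv_one, one_mul]
    exact Subgroup.mem_zpowers _
  have hsr : ∀ i : ZMod n, DihedralGroup.sr i • x₀ = DihedralGroup.r (-i) • x₀ := by
    intro i
    conv_rhs => rw [← hs, ← mul_smul, DihedralGroup.r_mul_sr, zero_sub, neg_neg]
  have hbij : Function.Bijective fun i : ZMod n => DihedralGroup.r i • x₀ := by
    constructor
    · intro i j hij
      have h := congrArg e hij
      simp only [hx₀] at h
      rw [QuotientGroup.eq, DihedralGroup.inv_r, DihedralGroup.r_mul_r] at h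
      obtain ⟨k, hk⟩ := h
      have hk' : (DihedralGroup.sr (0 : ZMod n)) ^ k = DihedralGroup.r (-i + j) := hk
      rcases Int.even_or_odd' k with ⟨m, rfl | rfl⟩
      · rw [zpow_mul, zpow_two, DihedralGroup.sr_mul_self, one_zpow, DihedralGroup.one_def,
          DihedralGroup.r.injEq] at hk'
        linear_combination hk'
      · rw [zpow_add, zpow_mul, zpow_two, DihedralGroup.sr_mul_self, one_zpow, one_mul,
          zpow_one] at hk'
        cases hk'
    · intro x
      obtain ⟨g, hg⟩ := QuotientGroup.mk_surjective (e x)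
      have hgx : g • x₀ = x := e.injective ((hx₀ g).trans hg)
      rcases g with i | i
      · exact ⟨i, hgx⟩
      · exact ⟨-i, (hsr i).symm.trans hgx⟩
  let ψ := Equiv.ofBijective _ hbij
  have hψ : ∀ i, ψ i = DihedralGroup.r i • x₀ := fun _ => rfl
  refine ⟨ψ.symm, fun i x => ?_, fun i x => ?_⟩ <;> obtain ⟨j, rfl⟩ := ψ.surjective x <;>
    rw [Equiv.symm_apply_apply, Equiv.symm_apply_eq, hψ, hψ, ← mul_smul]
  · rw [DihedralGroup.r_mul_r]
  · rw [DihedralGroup.sr_mul_r, hsr]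

/-- Since `⟨r ^ d⟩` contains no reflection, a word has it as stabilizer iff the word is chiral of
period `d`. -/
lemma stabilizer_eq_dihedralC_iff {X B : Type*} [MulAction (DihedralGroup n) X] {φ : X ≃ ZMod n}
    (hr : ∀ i x, φ (DihedralGroup.r i • x) = i + φ x)
    (hs : ∀ i x, φ (DihedralGroup.sr i • x) = -(i + φ x)) {d : ℕ} (hd : d ∣ n) (f : MapSet X B) :
    MulAction.stabilizer (DihedralGroup n) f = dihedralC n d ↔
      IsChiralWord d (f ∘ φ.symm) := by
  have hf' : ∀ x y, φ x = y → (f ∘ φ.symm) y = f x := by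
    rintro x _ rfl
    exact congrArg f (φ.symm_apply_apply x)
  have hr' : ∀ i, DihedralGroup.r i ∈ MulAction.stabilizer (DihedralGroup n) f ↔
      cyclicPeriod (f ∘ φ.symm) ∣ i.val := by
    intro i
    rw [mem_stabilizer_mapSet, cyclicPeriod_dvd_val_iff, ← φ.forall_congr_right]
    exact forall_congr' fun x => (Eq.congr (hf' _ _ (hr i x)) (hf' _ _ rfl)).symm
  have hs' : ∀ i, DihedralGroup.sr i ∈ MulAction.stabilizer (DihedralGroup n) f ↔
      ReflectionInvariant i (f ∘ φ.symm) := by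
    intro i
    rw [mem_stabilizer_mapSet, ReflectionInvariant, ← φ.forall_congr_right]
    exact forall_congr' fun x => (Eq.congr (hf' _ _ (hs i x)) (hf' _ _ rfl)).symm
  constructor
  · intro h
    rw [h] at hr' hs'
    refine ⟨?_, fun ⟨j, hj⟩ => sr_notMem_dihedralC d j ((hs' j).2 hj)⟩
    -- Both numbers divide `n`, so they may be tested on `k % n`, the value of `k` in `ZMod n`.
    have hiff : ∀ k : ℕ, d ∣ k ↔ cyclicPeriod (f ∘ φ.symm) ∣ k := by
      intro k
      have := (r_mem_dihedralC hd (k : ZMod n)).symm.trans (hr' k)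
      rwa [ZMod.val_natCast, Nat.dvd_mod_iff hd, Nat.dvd_mod_iff (cyclicPeriod_dvd _)] at this
    exact Nat.dvd_antisymm ((hiff d).1 dvd_rfl) ((hiff _).2 dvd_rfl)
  · rintro ⟨hp, hj⟩
    ext g
    rcases g with i | i
    · rw [hr', hp, r_mem_dihedralC hd]
    · rw [hs']
      exact iff_of_false (fun h => hj ⟨i, h⟩) (sr_notMem_dihedralC d i)

end Orbits

section Transport
open Finset
open scoped Classical

/-! ### Nested colourings as words -/

variable {n : ℕ} {A : Type*} {a : A}

/-- The letter that stands for a colour: it has level `0` for `a` and level `1` for the others. -/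
noncomputable def colorLetter (a b : A) : NestedColor {0, 1} A a :=
  if h : b = a then ⟨⟨0, by simp⟩, Fin.elim0⟩ else ⟨⟨1, by simp⟩, fun _ => ⟨b, h⟩⟩

lemma colorLetter_self (a : A) : colorLetter a a = ⟨⟨0, by simp⟩, Fin.elim0⟩ := dif_pos rfl

lemma colorLetter_of_ne {b : A} (h : b ≠ a) :
    colorLetter a b = ⟨⟨1, by simp⟩, fun _ => ⟨b, h⟩⟩ := dif_neg h

/-- The letters of level `0` and `1` are the colours. -/
noncomputable def nestedColorEquiv (a : A) : A ≃ NestedColor {0, 1} A a where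
  toFun := colorLetter a
  invFun c := if h : 0 < (c.1 : ℕ) then (c.2 ⟨0, h⟩).1 else a
  left_inv b := by
    by_cases hb : b = a
    · subst hb
      rw [colorLetter_self]
      exact dif_neg (lt_irrefl 0)
    · rw [colorLetter_of_ne hb]
      exact dif_pos one_pos
  right_inv := by
    rintro ⟨⟨k, rfl | rfl⟩, c⟩
    · refine (congrArg (colorLetter a) (dif_neg (lt_irrefl 0))).trans ?_
      rw [colorLetter_self]
      congr 1
      exact Subsingleton.elim _ _
    · refine (congrArg (colorLetter a) (dif_pos one_pos)).trans ?_
      refine (colorLetter_of_ne (c 0).2).trans ?_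
      congr 1
      funext j
      exact congrArg c (Subsingleton.elim 0 j)

lemma nestedColorEquiv_fst (b : A) :
    (((nestedColorEquiv a b).1 : ({0, 1} : Set ℕ)) : ℕ) = if b = a then 0 else 1 := by
  change ((colorLetter a b).1 : ℕ) = _
  split_ifs with h
  · rw [h, colorLetter_self]
  · rw [colorLetter_of_ne h]

/-- The number of letters of a word that differ from `a`. -/
noncomputable def wordDegree (a : A) {X : Type*} (f : X → A) : ℕ := Nat.card {x // f x ≠ a}

/-- The elements of the nested set as words over `A`, in the coordinates `φ` on `X`. -/
noncomputable def nestedWordEquiv {X : Type*} (φ : X ≃ ZMod n) (a : A) :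
    NestedSet {0, 1} A a X ≃ (ZMod n → A) :=
  Equiv.arrowCongr φ (nestedColorEquiv a).symm

lemma wordDegree_comp_equiv {X Y : Type*} (e : X ≃ Y) (f : Y → A) :
    wordDegree a (f ∘ e) = wordDegree a f :=
  Nat.card_congr (e.subtypeEquiv fun _ => Iff.rfl)

lemma deg_eq_wordDegree {X : Type*} [Fintype X] (φ : X ≃ ZMod n)
    (f : NestedSet {0, 1} A a X) : f.deg = wordDegree a (nestedWordEquiv φ a f) := by
  have h1 : wordDegree a (nestedWordEquiv φ a f) =
      wordDegree a (fun x => (nestedColorEquiv a).symm (f x)) :=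
    wordDegree_comp_equiv φ.symm (fun x => (nestedColorEquiv a).symm (f x))
  rw [h1, wordDegree, Nat.card_eq_fintype_card, Fintype.card_subtype, card_filter, NestedSet.deg]
  refine sum_congr rfl fun x _ => ?_
  obtain ⟨b, hb⟩ := (nestedColorEquiv a).surjective (f x)
  rw [← hb, nestedColorEquiv_fst, Equiv.symm_apply_apply]
  by_cases h : b = a <;> simp [h]

instance finite_nestedSet [Finite A] {X : Type*} [Finite X] : Finite (NestedSet {0, 1} A a X) :=
  have : Finite (NestedColor {0, 1} A a) := Finite.of_equiv A (nestedColorEquiv a)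
  inferInstanceAs (Finite (X → NestedColor {0, 1} A a))

instance finite_mapSet [Finite A] {X : Type*} [Finite X] : Finite (MapSet X A) :=
  inferInstanceAs (Finite (X → A))

section Counts

variable [NeZero n] {X : Type*} [MulAction (DihedralGroup n) X]
  {φ : X ≃ ZMod n}

lemma stabilizer_nestedSet_iff (hr : ∀ i x, φ (DihedralGroup.r i • x) = i + φ x)
    (hs : ∀ i x, φ (DihedralGroup.sr i • x) = -(i + φ x)) {d : ℕ} (hd : d ∣ n)
    (f : NestedSet {0, 1} A a X) :
    MulAction.stabilizer (DihedralGroup n) f = dihedralC n d ↔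
      IsChiralWord d (nestedWordEquiv φ a f) :=
  (stabilizer_eq_dihedralC_iff hr hs hd f).trans
    (isChiralWord_comp_iff (nestedColorEquiv a).symm.injective d (f ∘ φ.symm)).symm

lemma orbitCount_nestedSet [Finite A] [Finite X]
    (hr : ∀ i x, φ (DihedralGroup.r i • x) = i + φ x)
    (hs : ∀ i x, φ (DihedralGroup.sr i • x) = -(i + φ x)) {d : ℕ} (hd : d ∣ n) :
    orbitCount (dihedralC n d) (NestedSet {0, 1} A a X) * (2 * d) =
      Nat.card {f : ZMod n → A // IsChiralWord d f} := by
  have := dihedralC_normal hd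
  rw [← dihedralC_index hd, orbitCount_mul_index]
  exact Nat.card_congr ((nestedWordEquiv φ a).subtypeEquiv (stabilizer_nestedSet_iff hr hs hd))

lemma orbitCount_nestedDegree [Finite A] [Fintype X]
    (hr : ∀ i x, φ (DihedralGroup.r i • x) = i + φ x)
    (hs : ∀ i x, φ (DihedralGroup.sr i • x) = -(i + φ x)) {d : ℕ} (hd : d ∣ n) (i : ℕ) :
    orbitCount (dihedralC n d) (nestedDegree (DihedralGroup n) {0, 1} A a X i) * (2 * d) =
      Nat.card {f : ZMod n → A // IsChiralWord d f ∧ wordDegree a f = i} := by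
  have := dihedralC_normal hd
  have : Finite (nestedDegree (DihedralGroup n) {0, 1} A a X i) := Subtype.finite
  rw [← dihedralC_index hd, orbitCount_mul_index]
  refine Nat.card_congr ⟨fun f => ⟨nestedWordEquiv φ a f.1.1, ?_, ?_⟩,
    fun f => ⟨⟨(nestedWordEquiv φ a).symm f.1, ?_⟩, ?_⟩, ?_, ?_⟩
  · rw [← stabilizer_nestedSet_iff hr hs hd, ← SubMulAction.stabilizer_of_subMul]
    exact f.2
  · rw [← deg_eq_wordDegree]
    exact f.1.2
  · change NestedSet.deg _ = i
    rw [deg_eq_wordDegree φ, Equiv.apply_symm_apply]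
    exact f.2.2
  · rw [SubMulAction.stabilizer_of_subMul, stabilizer_nestedSet_iff hr hs hd,
      Equiv.apply_symm_apply]
    exact f.2.1
  · intro f
    apply Subtype.ext
    apply Subtype.ext
    exact Equiv.symm_apply_apply _ _
  · intro f
    apply Subtype.ext
    exact Equiv.apply_symm_apply _ _

/-- The case `d = n`, as `C_1` is trivial. -/
lemma isPrimitiveColoring_iff_isChiralWord (hr : ∀ i x, φ (DihedralGroup.r i • x) = i + φ x)
    (hs : ∀ i x, φ (DihedralGroup.sr i • x) = -(i + φ x)) (f : MapSet X A) :
    IsPrimitiveColoring (DihedralGroup n) f ↔ IsChiralWord n (f ∘ φ.symm) := by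
  rw [isPrimitiveColoring_iff, ← dihedralC_self, stabilizer_eq_dihedralC_iff hr hs dvd_rfl]

lemma IsPrimitiveColoring.smul {f : MapSet X A} (hf : IsPrimitiveColoring (DihedralGroup n) f)
    (g : DihedralGroup n) : IsPrimitiveColoring (DihedralGroup n) (g • f) := by
  rw [isPrimitiveColoring_iff] at hf ⊢
  exact stabilizer_smul_eq_of_normal g hf

lemma primitiveCount_mul [Finite A] [Finite X]
    (hr : ∀ i x, φ (DihedralGroup.r i • x) = i + φ x)
    (hs : ∀ i x, φ (DihedralGroup.sr i • x) = -(i + φ x)) :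
    primitiveCount (DihedralGroup n) X A * (2 * n) =
      Nat.card {f : ZMod n → A // IsChiralWord n f} := by
  rw [← DihedralGroup.nat_card, primitiveCount,
    card_orbits_mul (T := fun f : MapSet X A => IsPrimitiveColoring (DihedralGroup n) f)
      (fun g f hf => IsPrimitiveColoring.smul hf g) (fun f hf => hf)]
  exact Nat.card_congr ((φ.arrowCongr (Equiv.refl A)).subtypeEquiv
    (isPrimitiveColoring_iff_isChiralWord hr hs))

lemma primitiveCountDegree_mul [Finite A] [Finite X]
    (hr : ∀ i x, φ (DihedralGroup.r i • x) = i + φ x)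
    (hs : ∀ i x, φ (DihedralGroup.sr i • x) = -(i + φ x)) (i : ℕ) :
    primitiveCountDegree (DihedralGroup n) X a i * (2 * n) =
      Nat.card {f : ZMod n → A // IsChiralWord n f ∧ wordDegree a f = i} := by
  rw [← DihedralGroup.nat_card, primitiveCountDegree, card_orbits_mul
    (T := fun f : MapSet X A => IsPrimitiveColoring (DihedralGroup n) f ∧
      Nat.card {x : X // f x ≠ a} = i) _ (fun f hf => hf.1)]
  · refine Nat.card_congr ((φ.arrowCongr (Equiv.refl A)).subtypeEquiv fun f => and_congr
      (isPrimitiveColoring_iff_isChiralWord hr hs f) ?_)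
    exact Eq.congr (wordDegree_comp_equiv φ.symm f).symm rfl
  · rintro g f ⟨hf, hi⟩
    refine ⟨hf.smul g, ?_⟩
    exact (wordDegree_comp_equiv (MulAction.toPerm g⁻¹) f).trans hi

end Counts

/-! ### Weights -/

lemma powerSum_eq_colorFactor [Fintype A] (a : A) (m : ℕ) :
    powerSum (fun b => if b = a then (1 : PowerSeries ℚ) else PowerSeries.X) m =
      colorFactor a m := by
  simp only [powerSum, ite_pow, one_pow]
  rw [sum_ite, sum_const, sum_const, colorFactor, Nat.card_eq_fintype_card, Fintype.card_subtype,
    nsmul_eq_mul, filter_eq' univ a]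
  simp

lemma coeff_sum_wordDegree [NeZero n] [Fintype A] (a : A) (d i : ℕ) :
    PowerSeries.coeff i (∑ f : ZMod n → A with IsChiralWord d f,
      ∏ x, if f x = a then (1 : PowerSeries ℚ) else PowerSeries.X) =
    Nat.card {f : ZMod n → A // IsChiralWord d f ∧ wordDegree a f = i} := by
  have h : ∀ f : ZMod n → A, (∏ x, if f x = a then (1 : PowerSeries ℚ) else PowerSeries.X) =
      PowerSeries.X ^ wordDegree a f := by
    intro f
    rw [prod_ite, prod_const_one, one_mul, prod_const, wordDegree, Nat.card_eq_fintype_card,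
      Fintype.card_subtype]
  simp only [h, map_sum, PowerSeries.coeff_X_pow]
  rw [sum_boole, Nat.card_eq_fintype_card, Fintype.card_subtype, filter_filter]
  simp only [eq_comm]

variable [NeZero n] [Finite A] {X : Type*} [Fintype X] [MulAction (DihedralGroup n) X]
  {φ : X ≃ ZMod n}

/-- The graded formula, before the distinction by the parity of `d`. -/
theorem four_mul_orbitSeries (hr : ∀ i x, φ (DihedralGroup.r i • x) = i + φ x)
    (hs : ∀ i x, φ (DihedralGroup.sr i • x) = -(i + φ x)) {d : ℕ} (hd : d ∣ n) :
    4 * d * orbitSeries (dihedralC n d) {0, 1} A a X =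
      ∑ e ∈ d.divisors, moebiusConst (d / e) * (2 * colorFactor a (n / e) ^ e -
        d * if 2 ∣ e then
          colorFactor a (n / e) ^ 2 * colorFactor a (2 * n / e) ^ (e / 2 - 1) +
            colorFactor a (2 * n / e) ^ (e / 2)
        else 2 * (colorFactor a (n / e) * colorFactor a (2 * n / e) ^ ((e - 1) / 2))) := by
  have := Fintype.ofFinite A
  have : CharZero (PowerSeries ℚ) := algebraRat.charZero _
  have hW : (2 * d) * orbitSeries (dihedralC n d) {0, 1} A a X =
      ∑ f : ZMod n → A with IsChiralWord d f,
        ∏ x, if f x = a then (1 : PowerSeries ℚ) else PowerSeries.X := by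
    ext i
    rw [coeff_sum_wordDegree, ← orbitCount_nestedDegree hr hs hd,
      show (2 * d : PowerSeries ℚ) = PowerSeries.C (2 * d : ℚ) by
      rw [map_mul, map_natCast, map_ofNat], PowerSeries.coeff_C_mul,
      orbitSeries, PowerSeries.coeff_mk]
    push_cast
    ring
  rw [show (4 * d : PowerSeries ℚ) = 2 * (2 * d) by ring, mul_assoc, hW]
  refine (two_mul_sum_chiral hd
    fun b => if b = a then (1 : PowerSeries ℚ) else PowerSeries.X).trans ?_
  refine sum_congr rfl fun e he => ?_
  rw [moebiusConst, map_intCast, palindromeWeight]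
  simp only [powerSum_eq_colorFactor]
  rw [Nat.mul_div_assoc 2 ((Nat.dvd_of_mem_divisors he).trans hd), mul_comm (n / e) 2]

/-- The ungraded formula, before the distinction by the parity of `d`. -/
theorem four_mul_orbitCount (hr : ∀ i x, φ (DihedralGroup.r i • x) = i + φ x)
    (hs : ∀ i x, φ (DihedralGroup.sr i • x) = -(i + φ x)) {d : ℕ} (hd : d ∣ n) :
    4 * d * (orbitCount (dihedralC n d) (NestedSet {0, 1} A a X) : ℝ) =
      ∑ e ∈ d.divisors, (ArithmeticFunction.moebius (d / e) : ℝ) * (2 * (Nat.card A : ℝ) ^ e -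
        d * if 2 ∣ e then
          (Nat.card A : ℝ) ^ 2 * (Nat.card A : ℝ) ^ (e / 2 - 1) + (Nat.card A : ℝ) ^ (e / 2)
        else 2 * ((Nat.card A : ℝ) * (Nat.card A : ℝ) ^ ((e - 1) / 2))) := by
  have := Fintype.ofFinite A
  have hW : (2 * d) * (orbitCount (dihedralC n d) (NestedSet {0, 1} A a X) : ℝ) =
      ∑ f : ZMod n → A with IsChiralWord d f, ∏ x, (fun _ => (1 : ℝ)) (f x) := by
    simp only [prod_const_one, sum_const, nsmul_eq_mul, mul_one]
    rw [← Fintype.card_subtype, ← Nat.card_eq_fintype_card, ← orbitCount_nestedSet hr hs hd]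
    push_cast
    ring
  have hp : ∀ m, powerSum (fun _ : A => (1 : ℝ)) m = Nat.card A := by
    intro m
    simp [powerSum]
  rw [show (4 * d : ℝ) = 2 * (2 * d) by ring, mul_assoc, hW]
  refine (two_mul_sum_chiral hd fun _ => (1 : ℝ)).trans ?_
  simp only [palindromeWeight, hp]

end Transport

/-! ### Möbius sums by the parity of `d` -/

lemma moebius_two_mul_of_odd {m : ℕ} (hm : ¬ 2 ∣ m) :
    ArithmeticFunction.moebius (2 * m) = -ArithmeticFunction.moebius m := by
  rw [ArithmeticFunction.isMultiplicative_moebius.map_mul_of_coprime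
    ((Nat.Prime.coprime_iff_not_dvd Nat.prime_two).2 hm),
    ArithmeticFunction.moebius_apply_prime Nat.prime_two, neg_one_mul]

/-- For odd `m`, the divisors of `2 m` are those of `m` and their doubles, with opposite Möbius
values. -/
lemma sum_moebius_two_mul {K : Type*} [CommRing K] {m : ℕ} (hm : ¬ 2 ∣ m) (g : ℕ → K) :
    ∑ e ∈ (2 * m).divisors, (ArithmeticFunction.moebius (2 * m / e) : K) * g e =
      ∑ e ∈ m.divisors, (ArithmeticFunction.moebius (m / e) : K) * (g (2 * e) - g e) := by
  have hm0 : m ≠ 0 := fun h => hm (h ▸ dvd_zero 2)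
  rw [← Finset.sum_filter_add_sum_filter_not _ (fun e => 2 ∣ e)]
  have heven : (2 * m).divisors.filter (fun e => 2 ∣ e) = m.divisors.image (2 * ·) := by
    ext e
    simp only [Finset.mem_filter, Nat.mem_divisors, Finset.mem_image]
    constructor
    · rintro ⟨⟨h, -⟩, k, rfl⟩
      exact ⟨k, ⟨Nat.dvd_of_mul_dvd_mul_left two_pos h, hm0⟩, rfl⟩
    · rintro ⟨k, ⟨h, -⟩, rfl⟩
      exact ⟨⟨Nat.mul_dvd_mul_left 2 h, by omega⟩, dvd_mul_right 2 k⟩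
  have hodd : (2 * m).divisors.filter (fun e => ¬ 2 ∣ e) = m.divisors := by
    ext e
    simp only [Finset.mem_filter, Nat.mem_divisors]
    constructor
    · rintro ⟨⟨h, -⟩, h2⟩
      exact ⟨(((Nat.Prime.coprime_iff_not_dvd Nat.prime_two).2 h2).symm).dvd_of_dvd_mul_left h, hm0⟩
    · rintro ⟨h, -⟩
      exact ⟨⟨h.mul_left 2, by omega⟩, fun h2 => hm (h2.trans h)⟩
  rw [heven, hodd, Finset.sum_image (fun x _ y _ h => Nat.eq_of_mul_eq_mul_left two_pos h),
    ← Finset.sum_add_distrib]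
  refine Finset.sum_congr rfl fun e he => ?_
  have hd := Nat.dvd_of_mem_divisors he
  rw [Nat.mul_div_mul_left _ _ two_pos, Nat.mul_div_assoc 2 hd,
    moebius_two_mul_of_odd fun h => hm (h.trans (Nat.div_dvd_of_dvd hd))]
  push_cast
  ring

/-- In the case `4 ∣ d` the quotient `d / e` by an odd `e` is divisible by `4`. -/
lemma moebius_div_eq_zero {d e : ℕ} (h4 : 4 ∣ d) (he : e ∣ d) (h2 : ¬ 2 ∣ e) :
    ArithmeticFunction.moebius (d / e) = 0 := by
  apply ArithmeticFunction.moebius_eq_zero_of_not_squarefree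
  intro hsq
  have hc : Nat.Coprime 4 e :=
    Nat.Coprime.pow_left 2 ((Nat.Prime.coprime_iff_not_dvd Nat.prime_two).2 h2)
  have h : 2 * 2 ∣ d / e :=
    hc.dvd_of_dvd_mul_left (by rwa [Nat.mul_div_cancel' he])
  exact absurd (hsq 2 h) (by decide)

lemma moebiusConst_eq (m : ℕ) :
    moebiusConst m = ((ArithmeticFunction.moebius m : ℤ) : PowerSeries ℚ) :=
  map_intCast _ _

lemma sqrt_mul_sqrt_pow_of_odd {k : ℝ} (hk : 0 ≤ k) {e : ℕ} (he : ¬ 2 ∣ e) :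
    √k * √k ^ e = k * k ^ ((e - 1) / 2) := by
  obtain ⟨j, rfl⟩ : ∃ j, e = 2 * j + 1 := ⟨e / 2, by omega⟩
  rw [Nat.add_sub_cancel, Nat.mul_div_cancel_left _ two_pos, pow_succ, pow_mul, Real.sq_sqrt hk]
  linear_combination k ^ j * Real.mul_self_sqrt hk

/-! ### The formulas by the parity of `d` -/

section Formulas

variable {n : ℕ} [NeZero n] {A : Type*} {a : A} [Finite A] {X : Type*} [Fintype X]
  [MulAction (DihedralGroup n) X]

lemma natCast_powerSeries_ne_zero {d : ℕ} (hd : d ∣ n) : (4 * d : PowerSeries ℚ) ≠ 0 := by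
  have : CharZero (PowerSeries ℚ) := algebraRat.charZero _
  have hd0 : d ≠ 0 := fun h => NeZero.ne n (Nat.eq_zero_of_zero_dvd (h ▸ hd))
  exact mul_ne_zero (by norm_num) (Nat.cast_ne_zero.2 hd0)

lemma C_one_div_two_mul {d : ℕ} (hd : d ∣ n) :
    (4 * d : PowerSeries ℚ) * PowerSeries.C (1 / (2 * (d : ℚ))) = 2 := by
  have hd0 : (d : ℚ) ≠ 0 := Nat.cast_ne_zero.2 fun h =>
    NeZero.ne n (Nat.eq_zero_of_zero_dvd (h ▸ hd))
  rw [show (4 * d : PowerSeries ℚ) = PowerSeries.C (4 * d : ℚ) by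
    rw [map_mul, map_natCast, map_ofNat], ← map_mul,
    show (4 * d : ℚ) * (1 / (2 * d)) = 2 by field_simp; norm_num, map_ofNat]

lemma two_mul_C_half : (2 : PowerSeries ℚ) * PowerSeries.C (1 / 2 : ℚ) = 1 := by
  rw [show (2 : PowerSeries ℚ) = PowerSeries.C 2 by rw [map_ofNat], ← map_mul]
  norm_num

lemma four_mul_C_quarter : (4 : PowerSeries ℚ) * PowerSeries.C (1 / 4 : ℚ) = 1 := by
  rw [show (4 : PowerSeries ℚ) = PowerSeries.C 4 by rw [map_ofNat], ← map_mul]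
  norm_num

theorem orbitSeries_of_odd
    (hX : GIsomorphic (DihedralGroup n) X (DihedralGroup n ⧸ dihedralD1 n)) {d : ℕ} (hd : d ∣ n)
    (h2 : ¬ 2 ∣ d) :
    orbitSeries (dihedralC n d) {0, 1} A a X =
      ∑ e ∈ d.divisors, moebiusConst (d / e) *
        (PowerSeries.C (1 / (2 * (d : ℚ))) * colorFactor a (n / e) ^ e
          - PowerSeries.C (1 / 2 : ℚ) * (colorFactor a (n / e) *
              colorFactor a (2 * n / e) ^ ((e - 1) / 2))) := by
  obtain ⟨φ, hr, hs⟩ := exists_equiv_zmod hX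
  refine mul_left_cancel₀ (natCast_powerSeries_ne_zero hd) ?_
  rw [four_mul_orbitSeries hr hs hd, Finset.mul_sum]
  refine Finset.sum_congr rfl fun e he => ?_
  rw [if_neg fun h => h2 (h.trans (Nat.dvd_of_mem_divisors he))]
  linear_combination
    -(moebiusConst (d / e) * colorFactor a (n / e) ^ e) * C_one_div_two_mul hd +
    2 * moebiusConst (d / e) * d * colorFactor a (n / e) *
      colorFactor a (2 * n / e) ^ ((e - 1) / 2) * two_mul_C_half

theorem orbitSeries_of_two_dvd
    (hX : GIsomorphic (DihedralGroup n) X (DihedralGroup n ⧸ dihedralD1 n)) {d : ℕ} (hd : d ∣ n)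
    (h2 : 2 ∣ d) (h4 : ¬ 4 ∣ d) :
    orbitSeries (dihedralC n d) {0, 1} A a X =
      PowerSeries.C (1 / (2 * (d : ℚ))) *
          ∑ e ∈ d.divisors, moebiusConst (d / e) * colorFactor a (n / e) ^ e
        - PowerSeries.C (1 / 4 : ℚ) *
          ∑ e ∈ (d / 2).divisors, moebiusConst (d / (2 * e)) *
            (-2 * (colorFactor a (n / e) * colorFactor a (2 * n / e) ^ ((e - 1) / 2))
              + colorFactor a (n / (2 * e)) ^ 2 * colorFactor a (n / e) ^ (e - 1)
              + colorFactor a (n / e) ^ e) := by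
  obtain ⟨φ, hr, hs⟩ := exists_equiv_zmod hX
  obtain ⟨m, rfl⟩ := h2
  have hm : ¬ 2 ∣ m := fun h => h4 (Nat.mul_dvd_mul_left 2 h)
  refine mul_left_cancel₀ (natCast_powerSeries_ne_zero hd) ?_
  rw [four_mul_orbitSeries hr hs hd]
  simp only [mul_sub, Finset.sum_sub_distrib, mul_left_comm (moebiusConst _) ((2 * m : ℕ) : _) _]
  rw [← Finset.mul_sum (Nat.divisors (2 * m))]
  simp only [moebiusConst_eq]
  rw [sum_moebius_two_mul hm (fun e => if 2 ∣ e then _ else _),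
    Nat.mul_div_cancel_left m two_pos]
  have hsum : ∑ e ∈ m.divisors, ((ArithmeticFunction.moebius (m / e) : ℤ) : PowerSeries ℚ) *
      ((if 2 ∣ 2 * e then
          colorFactor a (n / (2 * e)) ^ 2 * colorFactor a (2 * n / (2 * e)) ^ (2 * e / 2 - 1) +
            colorFactor a (2 * n / (2 * e)) ^ (2 * e / 2)
        else 2 * (colorFactor a (n / (2 * e)) *
          colorFactor a (2 * n / (2 * e)) ^ ((2 * e - 1) / 2))) -
      if 2 ∣ e then
          colorFactor a (n / e) ^ 2 * colorFactor a (2 * n / e) ^ (e / 2 - 1) +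
            colorFactor a (2 * n / e) ^ (e / 2)
        else 2 * (colorFactor a (n / e) * colorFactor a (2 * n / e) ^ ((e - 1) / 2))) =
      ∑ e ∈ m.divisors,
        ((ArithmeticFunction.moebius (2 * m / (2 * e)) : ℤ) : PowerSeries ℚ) *
        (-2 * (colorFactor a (n / e) * colorFactor a (2 * n / e) ^ ((e - 1) / 2))
          + colorFactor a (n / (2 * e)) ^ 2 * colorFactor a (n / e) ^ (e - 1)
          + colorFactor a (n / e) ^ e) := by
    refine Finset.sum_congr rfl fun e he => ?_
    rw [if_pos (dvd_mul_right 2 e), if_neg fun h => hm (h.trans (Nat.dvd_of_mem_divisors he)),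
      Nat.mul_div_mul_left _ _ two_pos, Nat.mul_div_mul_left _ _ two_pos,
      Nat.mul_div_cancel_left _ two_pos]
    ring
  rw [hsum]
  simp only [mul_left_comm ((ArithmeticFunction.moebius _ : ℤ) : PowerSeries ℚ) 2
    (colorFactor a _ ^ _)]
  rw [← Finset.mul_sum (Nat.divisors (2 * m))]
  linear_combination
    -(∑ e ∈ (2 * m).divisors, ((ArithmeticFunction.moebius (2 * m / e) : ℤ) : PowerSeries ℚ) *
      colorFactor a (n / e) ^ e) * C_one_div_two_mul hd +
    ((2 * m : ℕ) : PowerSeries ℚ) * (∑ e ∈ m.divisors,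
      ((ArithmeticFunction.moebius (2 * m / (2 * e)) : ℤ) : PowerSeries ℚ) *
        (-2 * (colorFactor a (n / e) * colorFactor a (2 * n / e) ^ ((e - 1) / 2))
          + colorFactor a (n / (2 * e)) ^ 2 * colorFactor a (n / e) ^ (e - 1)
          + colorFactor a (n / e) ^ e)) * four_mul_C_quarter

theorem orbitSeries_of_four_dvd
    (hX : GIsomorphic (DihedralGroup n) X (DihedralGroup n ⧸ dihedralD1 n)) {d : ℕ} (hd : d ∣ n)
    (h4 : 4 ∣ d) :
    orbitSeries (dihedralC n d) {0, 1} A a X =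
      ∑ e ∈ d.divisors, moebiusConst (d / e) *
        (PowerSeries.C (1 / (2 * (d : ℚ))) * colorFactor a (n / e) ^ e
          - PowerSeries.C (1 / 4 : ℚ) * (colorFactor a (n / e) ^ 2 *
              colorFactor a (2 * n / e) ^ (e / 2 - 1))
          - PowerSeries.C (1 / 4 : ℚ) * colorFactor a (2 * n / e) ^ (e / 2)) := by
  obtain ⟨φ, hr, hs⟩ := exists_equiv_zmod hX
  refine mul_left_cancel₀ (natCast_powerSeries_ne_zero hd) ?_
  rw [four_mul_orbitSeries hr hs hd, Finset.mul_sum]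
  refine Finset.sum_congr rfl fun e he => ?_
  split_ifs with h2
  · linear_combination
      -(moebiusConst (d / e) * colorFactor a (n / e) ^ e) * C_one_div_two_mul hd +
      moebiusConst (d / e) * d * (colorFactor a (n / e) ^ 2 *
        colorFactor a (2 * n / e) ^ (e / 2 - 1) + colorFactor a (2 * n / e) ^ (e / 2)) *
        four_mul_C_quarter
  · rw [moebiusConst_eq, moebius_div_eq_zero h4 (Nat.dvd_of_mem_divisors he) h2]
    simp

lemma mul_necklaceM {d : ℕ} (hd : d ≠ 0) (k : ℝ) :
    d * necklaceM k d =
      ∑ e ∈ d.divisors, (ArithmeticFunction.moebius (d / e) : ℝ) * k ^ e := by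
  rw [necklaceM, ← mul_assoc, mul_one_div_cancel (Nat.cast_ne_zero.2 hd), one_mul]

theorem orbitCount_of_odd (a : A)
    (hX : GIsomorphic (DihedralGroup n) X (DihedralGroup n ⧸ dihedralD1 n)) {d : ℕ} (hd : d ∣ n)
    (h2 : ¬ 2 ∣ d) :
    (orbitCount (dihedralC n d) (NestedSet {0, 1} A a X) : ℝ) =
      1 / 2 * (necklaceM (Nat.card A) d
        - d * √(Nat.card A : ℝ) * necklaceM √(Nat.card A : ℝ) d) := by
  obtain ⟨φ, hr, hs⟩ := exists_equiv_zmod hX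
  have hd0 : d ≠ 0 := fun h => h2 (h ▸ dvd_zero 2)
  have hd0' : (4 * d : ℝ) ≠ 0 := mul_ne_zero four_ne_zero (Nat.cast_ne_zero.2 hd0)
  refine mul_left_cancel₀ hd0' ?_
  have hM : 4 * (d : ℝ) * (1 / 2 * (necklaceM (Nat.card A) d
        - d * √(Nat.card A : ℝ) * necklaceM √(Nat.card A : ℝ) d)) =
      2 * (d * necklaceM (Nat.card A) d) -
        2 * d * √(Nat.card A : ℝ) * (d * necklaceM √(Nat.card A : ℝ) d) := by ring
  rw [four_mul_orbitCount hr hs hd, hM, mul_necklaceM hd0, mul_necklaceM hd0, Finset.mul_sum,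
    Finset.mul_sum, ← Finset.sum_sub_distrib]
  refine Finset.sum_congr rfl fun e he => ?_
  have he2 : ¬ 2 ∣ e := fun h => h2 (h.trans (Nat.dvd_of_mem_divisors he))
  rw [if_neg he2]
  linear_combination 2 * d * (ArithmeticFunction.moebius (d / e) : ℝ) *
    sqrt_mul_sqrt_pow_of_odd (Nat.cast_nonneg (Nat.card A)) he2

theorem orbitCount_of_two_dvd (a : A)
    (hX : GIsomorphic (DihedralGroup n) X (DihedralGroup n ⧸ dihedralD1 n)) {d : ℕ} (hd : d ∣ n)
    (h2 : 2 ∣ d) (h4 : ¬ 4 ∣ d) :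
    (orbitCount (dihedralC n d) (NestedSet {0, 1} A a X) : ℝ) =
      1 / 2 * necklaceM (Nat.card A) d
        - d / 8 * (Nat.card A + 1) * necklaceM (Nat.card A) (d / 2)
        + d / 4 * √(Nat.card A : ℝ) * necklaceM √(Nat.card A : ℝ) (d / 2) := by
  obtain ⟨φ, hr, hs⟩ := exists_equiv_zmod hX
  obtain ⟨m, rfl⟩ := h2
  have hm : ¬ 2 ∣ m := fun h => h4 (Nat.mul_dvd_mul_left 2 h)
  have hm0 : m ≠ 0 := fun h => hm (h ▸ dvd_zero 2)
  have hd0 : 2 * m ≠ 0 := by omega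
  have hd0' : (4 * (2 * m : ℕ) : ℝ) ≠ 0 := mul_ne_zero four_ne_zero (Nat.cast_ne_zero.2 hd0)
  refine mul_left_cancel₀ hd0' ?_
  rw [four_mul_orbitCount hr hs hd, Nat.mul_div_cancel_left m two_pos]
  simp only [mul_sub, Finset.sum_sub_distrib,
    mul_left_comm ((ArithmeticFunction.moebius _ : ℤ) : ℝ) ((2 * m : ℕ) : ℝ) _,
    mul_left_comm ((ArithmeticFunction.moebius _ : ℤ) : ℝ) 2 ((Nat.card A : ℝ) ^ _)]
  rw [← Finset.mul_sum, ← Finset.mul_sum, ← mul_necklaceM hd0,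
    sum_moebius_two_mul hm (fun e => if 2 ∣ e then _ else _)]
  have hsum : ∑ e ∈ m.divisors, ((ArithmeticFunction.moebius (m / e) : ℤ) : ℝ) *
      ((if 2 ∣ 2 * e then (Nat.card A : ℝ) ^ 2 * (Nat.card A : ℝ) ^ (2 * e / 2 - 1) +
          (Nat.card A : ℝ) ^ (2 * e / 2)
        else 2 * ((Nat.card A : ℝ) * (Nat.card A : ℝ) ^ ((2 * e - 1) / 2))) -
      if 2 ∣ e then (Nat.card A : ℝ) ^ 2 * (Nat.card A : ℝ) ^ (e / 2 - 1) +
          (Nat.card A : ℝ) ^ (e / 2)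
        else 2 * ((Nat.card A : ℝ) * (Nat.card A : ℝ) ^ ((e - 1) / 2))) =
      (Nat.card A + 1) * (m * necklaceM (Nat.card A) m) -
        2 * √(Nat.card A : ℝ) * (m * necklaceM √(Nat.card A : ℝ) m) := by
    rw [mul_necklaceM hm0, mul_necklaceM hm0, Finset.mul_sum, Finset.mul_sum,
      ← Finset.sum_sub_distrib]
    refine Finset.sum_congr rfl fun e he => ?_
    have he2 : ¬ 2 ∣ e := fun h => hm (h.trans (Nat.dvd_of_mem_divisors he))
    obtain ⟨j, hj⟩ : ∃ j, e = j + 1 := ⟨e - 1, by omega⟩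
    have hpow : (Nat.card A : ℝ) ^ 2 * (Nat.card A : ℝ) ^ (e - 1) =
        Nat.card A * (Nat.card A : ℝ) ^ e := by
      rw [hj, Nat.add_sub_cancel]
      ring
    rw [if_pos (dvd_mul_right 2 e), if_neg he2, Nat.mul_div_cancel_left _ two_pos, hpow]
    linear_combination 2 * (ArithmeticFunction.moebius (m / e) : ℝ) *
      sqrt_mul_sqrt_pow_of_odd (Nat.cast_nonneg (Nat.card A)) he2
  rw [hsum]
  push_cast
  ring

theorem orbitCount_of_four_dvd (a : A)
    (hX : GIsomorphic (DihedralGroup n) X (DihedralGroup n ⧸ dihedralD1 n)) {d : ℕ} (hd : d ∣ n)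
    (h4 : 4 ∣ d) :
    (orbitCount (dihedralC n d) (NestedSet {0, 1} A a X) : ℝ) =
      1 / 2 * necklaceM (Nat.card A) d
        - d / 4 * (Nat.card A + 1) * necklaceM √(Nat.card A : ℝ) d := by
  obtain ⟨φ, hr, hs⟩ := exists_equiv_zmod hX
  have hd0 : d ≠ 0 := fun h => NeZero.ne n (Nat.eq_zero_of_zero_dvd (h ▸ hd))
  have hd0' : (4 * d : ℝ) ≠ 0 := mul_ne_zero four_ne_zero (Nat.cast_ne_zero.2 hd0)
  refine mul_left_cancel₀ hd0' ?_
  have hM : 4 * (d : ℝ) * (1 / 2 * necklaceM (Nat.card A) d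
        - d / 4 * (Nat.card A + 1) * necklaceM √(Nat.card A : ℝ) d) =
      2 * (d * necklaceM (Nat.card A) d) -
        d * (Nat.card A + 1) * (d * necklaceM √(Nat.card A : ℝ) d) := by ring
  rw [four_mul_orbitCount hr hs hd, hM, mul_necklaceM hd0, mul_necklaceM hd0, Finset.mul_sum,
    Finset.mul_sum, ← Finset.sum_sub_distrib]
  refine Finset.sum_congr rfl fun e he => ?_
  have hed := Nat.dvd_of_mem_divisors he
  split_ifs with h2
  · obtain ⟨j, rfl⟩ := h2
    have hj : j ≠ 0 := by
      rintro rfl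
      exact hd0 (Nat.eq_zero_of_zero_dvd hed)
    obtain ⟨i, rfl⟩ := Nat.exists_eq_succ_of_ne_zero hj
    rw [Nat.mul_div_cancel_left _ two_pos, pow_mul √_, Real.sq_sqrt (Nat.cast_nonneg _),
      Nat.succ_eq_add_one, Nat.add_sub_cancel]
    ring
  · rw [moebius_div_eq_zero h4 hed h2]
    simp

theorem coeff_orbitSeries_self
    (hX : GIsomorphic (DihedralGroup n) X (DihedralGroup n ⧸ dihedralD1 n)) (i : ℕ) :
    PowerSeries.coeff i (orbitSeries (dihedralC n n) {0, 1} A a X) =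
      (primitiveCountDegree (DihedralGroup n) X a i : ℚ) := by
  obtain ⟨φ, hr, hs⟩ := exists_equiv_zmod hX
  rw [orbitSeries, PowerSeries.coeff_mk, Nat.cast_inj]
  exact Nat.eq_of_mul_eq_mul_right (Nat.mul_pos two_pos (NeZero.pos n))
    ((orbitCount_nestedDegree hr hs dvd_rfl i).trans (primitiveCountDegree_mul hr hs i).symm)

theorem primitiveCount_eq_orbitCount (a : A)
    (hX : GIsomorphic (DihedralGroup n) X (DihedralGroup n ⧸ dihedralD1 n)) :
    primitiveCount (DihedralGroup n) X A =
      orbitCount (dihedralC n n) (NestedSet {0, 1} A a X) := by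
  obtain ⟨φ, hr, hs⟩ := exists_equiv_zmod hX
  exact Nat.eq_of_mul_eq_mul_right (Nat.mul_pos two_pos (NeZero.pos n))
    ((primitiveCount_mul hr hs).trans (orbitCount_nestedSet hr hs dvd_rfl).symm)

end Formulas

theorem mainTheorem8 (n : ℕ) [NeZero n] (A : Type*) [Finite A] (a : A)
    (X : Type*) [Fintype X] [MulAction (DihedralGroup n) X]
    (hX : GIsomorphic (DihedralGroup n) X (DihedralGroup n ⧸ dihedralD1 n)) :
    -- the graded formulas for `C_{n/d}`, for every divisor `d` of `n`
    (∀ d : ℕ, d ∣ n →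
      (¬ 2 ∣ d →
        orbitSeries (dihedralC n d) {0, 1} A a X =
          ∑ e ∈ d.divisors, moebiusConst (d / e) *
            (PowerSeries.C (1 / (2 * (d : ℚ))) * colorFactor a (n / e) ^ e
              - PowerSeries.C (1 / 2 : ℚ) * (colorFactor a (n / e) *
                  colorFactor a (2 * n / e) ^ ((e - 1) / 2)))) ∧
      (2 ∣ d → ¬ 4 ∣ d →
        orbitSeries (dihedralC n d) {0, 1} A a X =
          PowerSeries.C (1 / (2 * (d : ℚ))) *
              ∑ e ∈ d.divisors, moebiusConst (d / e) * colorFactor a (n / e) ^ e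
            - PowerSeries.C (1 / 4 : ℚ) *
              ∑ e ∈ (d / 2).divisors, moebiusConst (d / (2 * e)) *
                (-2 * (colorFactor a (n / e) * colorFactor a (2 * n / e) ^ ((e - 1) / 2))
                  + colorFactor a (n / (2 * e)) ^ 2 * colorFactor a (n / e) ^ (e - 1)
                  + colorFactor a (n / e) ^ e)) ∧
      (4 ∣ d →
        orbitSeries (dihedralC n d) {0, 1} A a X =
          ∑ e ∈ d.divisors, moebiusConst (d / e) *
            (PowerSeries.C (1 / (2 * (d : ℚ))) * colorFactor a (n / e) ^ e
              - PowerSeries.C (1 / 4 : ℚ) * (colorFactor a (n / e) ^ 2 *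
                  colorFactor a (2 * n / e) ^ (e / 2 - 1))
              - PowerSeries.C (1 / 4 : ℚ) * colorFactor a (2 * n / e) ^ (e / 2)))) ∧
    -- the formulas for the number of orbits isomorphic to `D_n / C_{n/d}`
    (∀ d : ℕ, d ∣ n →
      (¬ 2 ∣ d →
        (orbitCount (dihedralC n d) (NestedSet {0, 1} A a X) : ℝ) =
          1 / 2 * (necklaceM (Nat.card A) d
            - d * √(Nat.card A : ℝ) * necklaceM √(Nat.card A : ℝ) d)) ∧
      (2 ∣ d → ¬ 4 ∣ d →
        (orbitCount (dihedralC n d) (NestedSet {0, 1} A a X) : ℝ) =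
          1 / 2 * necklaceM (Nat.card A) d
            - d / 8 * (Nat.card A + 1) * necklaceM (Nat.card A) (d / 2)
            + d / 4 * √(Nat.card A : ℝ) * necklaceM √(Nat.card A : ℝ) (d / 2)) ∧
      (4 ∣ d →
        (orbitCount (dihedralC n d) (NestedSet {0, 1} A a X) : ℝ) =
          1 / 2 * necklaceM (Nat.card A) d
            - d / 4 * (Nat.card A + 1) * necklaceM √(Nat.card A : ℝ) d)) ∧
    -- for `d = n` the coefficients count primitive colorings by the number of places not colored `a`
    (∀ i : ℕ, PowerSeries.coeff i (orbitSeries (dihedralC n n) {0, 1} A a X) =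
      (primitiveCountDegree (DihedralGroup n) X a i : ℚ)) ∧
    -- the number of primitive colorings
    primitiveCount (DihedralGroup n) X A = orbitCount (dihedralC n n) (NestedSet {0, 1} A a X) ∧
    (¬ 2 ∣ n →
      (primitiveCount (DihedralGroup n) X A : ℝ) =
        1 / 2 * (necklaceM (Nat.card A) n
          - n * √(Nat.card A : ℝ) * necklaceM √(Nat.card A : ℝ) n)) ∧
    (2 ∣ n → ¬ 4 ∣ n →
      (primitiveCount (DihedralGroup n) X A : ℝ) =
        1 / 2 * necklaceM (Nat.card A) n
          - n / 8 * (Nat.card A + 1) * necklaceM (Nat.card A) (n / 2)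
          + n / 4 * √(Nat.card A : ℝ) * necklaceM √(Nat.card A : ℝ) (n / 2)) ∧
    (4 ∣ n →
      (primitiveCount (DihedralGroup n) X A : ℝ) =
        1 / 2 * necklaceM (Nat.card A) n
          - n / 4 * (Nat.card A + 1) * necklaceM √(Nat.card A : ℝ) n) := by
  rw [primitiveCount_eq_orbitCount a hX]
  exact ⟨fun d hd => ⟨orbitSeries_of_odd hX hd, orbitSeries_of_two_dvd hX hd,
      orbitSeries_of_four_dvd hX hd⟩,
    fun d hd => ⟨orbitCount_of_odd a hX hd, orbitCount_of_two_dvd a hX hd,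
      orbitCount_of_four_dvd a hX hd⟩,
    coeff_orbitSeries_self hX, rfl, orbitCount_of_odd a hX dvd_rfl,
    orbitCount_of_two_dvd a hX dvd_rfl, orbitCount_of_four_dvd a hX dvd_rfl⟩
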